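/- Let $p$ be an odd prime, let $n,g\ge 1$ be integers, let $A=(\mathbf Z/p^n\mathbf Z)^g$ and $K=A\times A$, and let $L^2(A)$ be the Hilbert space of complex functions on $A$ with the inner product given by summation over $A$. For $k=(x,y)\in K$ let $\mathcal W_k$ be the normalised Weyl operator $$(\mathcal W_kf)(u)=\chi_y(x/2)\,\chi_y(u-x)\,f(u-x),\qquad \chi_y(u)=e^{2\pi i\,y\cdot u/p^n}.$$ The group $Sp_{2g}(\mathbf Z/p^n\mathbf Z)$ acts on $K$ preserving the form $x\cdot y'-x'\cdot y$. The Weil representation $W$ of $Sp_{2g}(\mathbf Z/p^n\mathbf Z)$ is the projective unitary representation on $L^2(A)$ given by unitary operators $W(\sigma)$, unique up to scalars, such that $W(\sigma)\mathcal W_kW(\sigma)^{-1}=\mathcal W_{\sigma(k)}$ for all $k\in K$. The same definition, with $m\geq 0$ in place of $n$, gives the Weil representation $W_m$ of $Sp_{2g}(\mathbf Z/p^m\mathbf Z)$ on $L^2((\mathbf Z/p^m\mathbf Z)^g)$. For $0\le r\le\lfloor n/2\rfloor$ let $V_{n-2r}\subset L^2(A)$ be the space of functions supported on $p^rA$ and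 invariant under translation by $p^{n-r}A$, and let $V_{n-2r}^+$ and $V_{n-2r}^-$ be the subspaces of even and odd functions in $V_{n-2r}$. Let $U_{n-2r}^\pm$ be the orthogonal complement of $V_{n-2r-2}^\pm$ in $V_{n-2r}^\pm$ if $r<\lfloor n/2\rfloor$, and $U_{n-2r}^\pm=V_{n-2r}^\pm$ if $r=\lfloor n/2\rfloor$. For $m\le n$ let $N_m$ be the kernel of the natural map $Sp_{2g}(\mathbf Z/p^n\mathbf Z)\to Sp_{2g}(\mathbf Z/p^m\mathbf Z)$. The level of a projective representation of $Sp_{2g}(\mathbf Z/p^n\mathbf Z)$ is the smallest $m\in\{0,\dots,n\}$ for which every element of $N_m$ acts by a scalar multiple of the identity. Two projective unitary representations $\rho_1,\rho_2$ of a group on Hilbert spaces $\mathcal H_1,\mathcal H_2$ are equivalent if there is an isometry $\Phi$ of $\mathcal H_1$ onto $\mathcal H_2$ such that, for each element $\sigma$ of the group, $\Phi\circ\rho_1(\sigma)$ and $\rho_2(\sigma)\circ\Phi$ differ by a constant of absolute value one. **Theorem.** Let $0\le r\le\lfloor n/2\rfloor$. 1. The subspaces $U_{n-2r}^+$ and $U_{n-2r}^-$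 are invariant under $W$, and the restriction of $W$ to each of them has level $n-2r$, except possibly for $U_{n-2r}^-$ when $p=3$, $g=1$ and $n-2r=1$. 2. The subspace $V_{n-2r}$ is invariant under $W$. If $q:Sp_{2g}(\mathbf Z/p^n\mathbf Z)\to Sp_{2g}(\mathbf Z/p^{n-2r}\mathbf Z)$ denotes the natural reduction map, then $W_{n-2r}\circ q$ is equivalent to the restriction of $W$ to $V_{n-2r}$. -/

import Mathlib

noncomputable section

set_option linter.unusedSectionVars false

namespace FiniteWeil

open Matrix

/-- The Hilbert space `L²(A)` for `A = (ℤ/N)^g`, with inner product the sum over `A`. -/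
abbrev L2 (N g : ℕ) [NeZero N] : Type := EuclideanSpace ℂ (Fin g → ZMod N)

/-- `K = A × A`: the element `(x, y)` is the function `Sum.elim x y`. -/
abbrev PhaseSpace (N g : ℕ) : Type := Fin g ⊕ Fin g → ZMod N

/-- The symplectic group `Sp_{2g}(ℤ/N)`, acting on `K` by matrix-vector multiplication. -/
abbrev Sp (g N : ℕ) : Type := Matrix.symplecticGroup (Fin g) (ZMod N)

variable {N g : ℕ} [NeZero N]

/-- The character `χ_y (x) = exp (2 π i (y ⬝ x) / N)` of `A`. -/
def chi (y x : Fin g → ZMod N) : ℂ := ZMod.stdAddChar (y ⬝ᵥ x)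

/-- The translation operator `T_x f (u) = f (u - x)`. -/
def translation (x : Fin g → ZMod N) : L2 N g →ₗ[ℂ] L2 N g where
  toFun f := WithLp.toLp 2 fun u => f (u - x)
  map_add' f h := by ext u; simp
  map_smul' c f := by ext u; simp

/-- The modulation operator `M_y f (u) = χ_y (u) f (u)`. -/
def modulation (y : Fin g → ZMod N) : L2 N g →ₗ[ℂ] L2 N g where
  toFun f := WithLp.toLp 2 fun u => chi y u * f u
  map_add' f h := by ext u; simp [mul_add]
  map_smul' c f := by ext u; simp [mul_left_comm]

/-- For odd `N`, the normalised Weyl operator `χ_y (x / 2) T_x M_y` attached to `k = (x, y)`. -/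
def weyl (k : PhaseSpace N g) : Module.End ℂ (L2 N g) :=
  chi (k ∘ Sum.inr) ((2 : ZMod N)⁻¹ • (k ∘ Sum.inl)) •
    (translation (k ∘ Sum.inl) ∘ₗ modulation (k ∘ Sum.inr))

theorem weyl_apply (k : PhaseSpace N g) (f : L2 N g) (u : Fin g → ZMod N) :
    weyl k f u = chi (k ∘ Sum.inr) ((2 : ZMod N)⁻¹ • (k ∘ Sum.inl)) *
      (chi (k ∘ Sum.inr) (u - k ∘ Sum.inl) * f (u - k ∘ Sum.inl)) := rfl

theorem weyl_zero : weyl (0 : PhaseSpace N g) = 1 := by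
  ext f u
  rw [weyl_apply]
  have h1 : (0 : PhaseSpace N g) ∘ (Sum.inl : Fin g → _) = 0 := rfl
  have h2 : (0 : PhaseSpace N g) ∘ (Sum.inr : Fin g → _) = 0 := rfl
  simp [h1, h2, chi]

/-- The symplectic form on `K`, up to sign. -/
def omega (k l : PhaseSpace N g) : ZMod N := k ⬝ᵥ (J (Fin g) (ZMod N) *ᵥ l)

theorem omega_eq (k l : PhaseSpace N g) :
    omega k l = (k ∘ Sum.inr) ⬝ᵥ (l ∘ Sum.inl) - (k ∘ Sum.inl) ⬝ᵥ (l ∘ Sum.inr) := by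
  simp [omega, J, fromBlocks_mulVec, dotProduct, Fintype.sum_sum_type, Matrix.neg_mulVec]
  ring

theorem omega_sp (s : Sp g N) (k l : PhaseSpace N g) :
    omega (s.1 *ᵥ k) (s.1 *ᵥ l) = omega k l := by
  have h := SymplecticGroup.mem_iff'.1 s.2
  unfold omega
  conv_rhs => rw [← h]
  rw [Matrix.mulVec_mulVec, ← Matrix.vecMul_transpose, ← Matrix.dotProduct_mulVec,
    Matrix.mulVec_mulVec, Matrix.mul_assoc]

theorem half (hN : Odd N) : (2 : ZMod N)⁻¹ + (2 : ZMod N)⁻¹ = 1 := by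
  have h := ZMod.coe_mul_inv_eq_one (n := N) 2 (Nat.coprime_two_left.2 hN)
  push_cast at h
  rw [← h]; ring

theorem weyl_mul (hN : Odd N) (k l : PhaseSpace N g) :
    weyl k * weyl l = ZMod.stdAddChar ((2 : ZMod N)⁻¹ * omega k l) • weyl (k + l) := by
  have hh := half hN
  set t := (2 : ZMod N)⁻¹ with ht
  ext f u
  rw [Module.End.mul_apply, weyl_apply, weyl_apply, LinearMap.smul_apply, PiLp.smul_apply,
    weyl_apply, ← ht, omega_eq]
  have h1 : (k + l) ∘ (Sum.inl : Fin g → _) = k ∘ Sum.inl + l ∘ Sum.inl := rfl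
  have h2 : (k + l) ∘ (Sum.inr : Fin g → _) = k ∘ Sum.inr + l ∘ Sum.inr := rfl
  rw [h1, h2]
  generalize k ∘ (Sum.inl : Fin g → _) = x
  generalize k ∘ (Sum.inr : Fin g → _) = y
  generalize l ∘ (Sum.inl : Fin g → _) = z
  generalize l ∘ (Sum.inr : Fin g → _) = w
  rw [sub_sub, smul_eq_mul]
  simp only [chi, ← mul_assoc, ← AddChar.map_add_eq_mul]
  congr 2
  simp only [add_dotProduct, dotProduct_add, dotProduct_sub, dotProduct_smul, smul_eq_mul,
    dotProduct_comm x w]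
  linear_combination (w ⬝ᵥ x - y ⬝ᵥ z + y ⬝ᵥ z - w ⬝ᵥ x - y ⬝ᵥ z) * hh

theorem omega_add_left (k l m : PhaseSpace N g) : omega (k + l) m = omega k m + omega l m := by
  simp [omega, add_dotProduct]

theorem omega_add_right (k l m : PhaseSpace N g) : omega k (l + m) = omega k l + omega k m := by
  simp [omega, Matrix.mulVec_add]

theorem omega_neg_left (k m : PhaseSpace N g) : omega (-k) m = - omega k m := by
  simp [omega]

theorem omega_neg_right (k m : PhaseSpace N g) : omega k (-m) = - omega k m := by
  simp [omega, Matrix.mulVec_neg]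

theorem omega_swap (k l : PhaseSpace N g) : omega k l = - omega l k := by
  rw [omega_eq, omega_eq, dotProduct_comm (k ∘ Sum.inr), dotProduct_comm (k ∘ Sum.inl)]; ring

theorem omega_self (k : PhaseSpace N g) : omega k k = 0 := by
  rw [omega_eq, dotProduct_comm]; ring

theorem weyl_mul_neg (hN : Odd N) (k : PhaseSpace N g) : weyl k * weyl (-k) = 1 := by
  rw [weyl_mul hN, omega_neg_right, omega_self]; simp [weyl_zero]

theorem weyl_neg_mul (hN : Odd N) (k : PhaseSpace N g) : weyl (-k) * weyl k = 1 := by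
  rw [weyl_mul hN, omega_neg_left, omega_self]; simp [weyl_zero]

theorem weyl_conj (hN : Odd N) (k l : PhaseSpace N g) :
    weyl l * weyl k * weyl (-l) = ZMod.stdAddChar (omega l k) • weyl k := by
  rw [weyl_mul hN, smul_mul_assoc, weyl_mul hN, smul_smul, ← AddChar.map_add_eq_mul]
  have hh := half hN
  congr 2
  · rw [omega_neg_right, omega_add_left, omega_self, omega_swap k l]
    linear_combination omega l k * hh
  · abel_nf

theorem sum_omega (k : PhaseSpace N g) (hk : k ≠ 0) :
    ∑ l : PhaseSpace N g, (ZMod.stdAddChar (omega l k) : ℂ) = 0 := by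
  let ψ : AddChar (PhaseSpace N g) ℂ :=
    { toFun := fun l => ZMod.stdAddChar (omega l k)
      map_zero_eq_one' := by simp [omega]
      map_add_eq_mul' := fun a b => by rw [omega_add_left, AddChar.map_add_eq_mul] }
  have h : ψ ≠ 0 := by
    intro h0
    apply hk
    have h1 : ∀ l, omega l k = 0 := fun l => by
      apply ZMod.injective_stdAddChar
      rw [AddChar.map_zero_eq_one]
      exact DFunLike.congr_fun h0 l
    have h2 : J (Fin g) (ZMod N) *ᵥ k = 0 := by
      ext i
      have := h1 (Pi.single i 1)
      simpa [omega] using this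
    have h3 : J (Fin g) (ZMod N) *ᵥ (J (Fin g) (ZMod N) *ᵥ k) = 0 := by rw [h2]; simp
    rw [Matrix.mulVec_mulVec, J_squared] at h3
    simpa [Matrix.neg_mulVec] using h3
  exact AddChar.sum_eq_zero_iff_ne_zero.2 h

theorem sum_weyl_conj (hN : Odd N) (k : PhaseSpace N g) :
    ∑ l, weyl l * weyl k * weyl (-l) =
      if k = 0 then (Fintype.card (PhaseSpace N g) : ℂ) • (1 : Module.End ℂ (L2 N g)) else 0 := by
  simp_rw [weyl_conj hN, ← Finset.sum_smul]
  split_ifs with h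
  · subst h
    simp [omega, weyl_zero]
  · rw [sum_omega k h, zero_smul]

/-- `T` is an intertwiner for `s`: `T ∘ 𝒲_k = 𝒲_{s k} ∘ T` for all `k`. -/
def Intertwines (s : Sp g N) (T : Module.End ℂ (L2 N g)) : Prop :=
  ∀ k : PhaseSpace N g, T * weyl k = weyl (s.1 *ᵥ k) * T

/-- Averaging an operator over the Weyl operators. -/
def average (s : Sp g N) (B : Module.End ℂ (L2 N g)) : Module.End ℂ (L2 N g) :=
  ∑ k : PhaseSpace N g, weyl (s.1 *ᵥ k) * B * weyl (-k)

theorem average_intertwines (hN : Odd N) (s : Sp g N) (B : Module.End ℂ (L2 N g)) :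
    Intertwines s (average s B) := by
  intro l
  unfold average
  rw [Finset.sum_mul, Finset.mul_sum, ← Equiv.sum_comp (Equiv.addLeft l)]
  refine Finset.sum_congr rfl fun k _ => ?_
  simp only [Equiv.coe_addLeft]
  have e1 : weyl (-(l + k)) * weyl l =
      ZMod.stdAddChar ((2 : ZMod N)⁻¹ * omega l k) • weyl (-k) := by
    rw [weyl_mul hN]
    congr 2
    · rw [omega_neg_left, omega_add_left, omega_self, omega_swap k l]; ring_nf
    · abel
  have e2 : weyl (s.1 *ᵥ l) * weyl (s.1 *ᵥ k) =
      ZMod.stdAddChar ((2 : ZMod N)⁻¹ * omega l k) • weyl (s.1 *ᵥ (l + k)) := by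
    rw [weyl_mul hN, omega_sp, Matrix.mulVec_add]
  rw [mul_assoc, e1, ← mul_assoc, ← mul_assoc, e2]
  simp only [mul_smul_comm, smul_mul_assoc]

theorem exists_average_ne_zero (hN : Odd N) (s : Sp g N) :
    ∃ B : Module.End ℂ (L2 N g), average s B ≠ 0 := by
  by_contra! H
  have key : ∑ l : PhaseSpace N g, average s (weyl l) * weyl (-l) =
      (Fintype.card (PhaseSpace N g) : ℂ) • (1 : Module.End ℂ (L2 N g)) := by
    unfold average
    simp_rw [Finset.sum_mul]
    rw [Finset.sum_comm]
    simp_rw [mul_assoc]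
    simp_rw [← Finset.mul_sum, ← mul_assoc, sum_weyl_conj hN]
    rw [Finset.sum_eq_single 0]
    · simp [weyl_zero]
    · intro b _ hb; simp [hb]
    · simp
  simp only [H, zero_mul, Finset.sum_const_zero] at key
  have h2 := congrArg (fun T : Module.End ℂ (L2 N g) => T (EuclideanSpace.single 0 1) 0) key
  simp at h2
  exact pow_ne_zero (g + g) (Nat.cast_ne_zero.2 (NeZero.ne N)) h2.symm

theorem adjoint_weyl (hN : Odd N) (k : PhaseSpace N g) :
    LinearMap.adjoint (weyl k) = weyl (-k) := by
  have hn : ∀ f : L2 N g, ‖weyl k f‖ = ‖f‖ := fun f => by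
    have hc : ∀ y x : Fin g → ZMod N, ‖chi y x‖ = 1 := fun y x => by
      unfold chi; rw [ZMod.stdAddChar_apply]; exact Circle.norm_coe _
    rw [EuclideanSpace.norm_eq, EuclideanSpace.norm_eq]
    congr 1
    simp only [weyl_apply, norm_mul, hc, one_mul]
    exact Equiv.sum_comp (Equiv.subRight (k ∘ Sum.inl)) (fun u => ‖f u‖ ^ 2)
  let U : L2 N g →ₗᵢ[ℂ] L2 N g := ⟨weyl k, hn⟩
  symm
  rw [LinearMap.eq_adjoint_iff]
  intro f h
  rw [← U.inner_map_map]
  change inner ℂ ((weyl k * weyl (-k)) f) _ = _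
  rw [weyl_mul_neg hN]
  rfl

/-- An operator commuting with all Weyl operators is a scalar. -/
theorem commutant (S : Module.End ℂ (L2 N g))
    (hS : ∀ k : PhaseSpace N g, S * weyl k = weyl k * S) : ∃ c : ℂ, S = c • 1 := by
  have hS' : ∀ (k : PhaseSpace N g) (f : L2 N g), S (weyl k f) = weyl k (S f) :=
    fun k f => LinearMap.congr_fun (hS k) f
  let d : (Fin g → ZMod N) → L2 N g := fun w => EuclideanSpace.single w 1
  have hm : ∀ (y : Fin g → ZMod N) (f : L2 N g) (u : Fin g → ZMod N),
      weyl (Sum.elim 0 y) f u = chi y u * f u := fun y f u => by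
    rw [weyl_apply]; simp [chi]
  have ht : ∀ (x : Fin g → ZMod N) (f : L2 N g) (u : Fin g → ZMod N),
      weyl (Sum.elim x 0) f u = f (u - x) := fun x f u => by
    rw [weyl_apply]; simp [chi]
  have h1 : ∀ w u, u ≠ w → S (d w) u = 0 := by
    intro w u huw
    obtain ⟨i, hi⟩ := Function.ne_iff.1 huw
    have e1 : weyl (Sum.elim 0 (Pi.single i 1)) (d w) = chi (Pi.single i 1) w • d w := by
      ext v
      rw [hm, PiLp.smul_apply, smul_eq_mul]
      by_cases hv : v = w
      · rw [hv]
      · simp [d, hv]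
    have e2 := hS' (Sum.elim 0 (Pi.single i 1)) (d w)
    rw [e1, map_smul] at e2
    have e3 := congrArg (fun f : L2 N g => f u) e2
    simp only [hm, PiLp.smul_apply, smul_eq_mul] at e3
    have e4 : chi (Pi.single i 1) w ≠ chi (Pi.single i 1) u := by
      simp only [chi, single_dotProduct, one_mul]
      exact fun h => hi (ZMod.injective_stdAddChar h.symm)
    by_contra h0
    exact e4 (mul_right_cancel₀ h0 e3)
  have h2 : ∀ w, S (d w) w = S (d 0) 0 := by
    intro w
    have e1 : weyl (Sum.elim w 0) (d 0) = d w := by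
      ext v
      rw [ht]
      simp [d, sub_eq_zero]
    rw [← e1, hS', ht, sub_self]
  refine ⟨S (d 0) 0, ?_⟩
  refine (EuclideanSpace.basisFun (Fin g → ZMod N) ℂ).toBasis.ext fun w => ?_
  have e0 : (EuclideanSpace.basisFun (Fin g → ZMod N) ℂ).toBasis w = d w := by simp [d]
  rw [e0]
  ext u
  by_cases hu : u = w
  · subst hu; simp [h2, d]
  · simp [h1 w u hu, d, hu]

theorem exists_intertwiner (hN : Odd N) (s : Sp g N) :
    ∃ U : L2 N g ≃ₗᵢ[ℂ] L2 N g,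
      ∀ (k : PhaseSpace N g) (f : L2 N g), U (weyl k f) = weyl (s.1 *ᵥ k) (U f) := by
  obtain ⟨B, hB⟩ := exists_average_ne_zero hN s
  have hT := average_intertwines hN s B
  set T := average s B
  have hadj : ∀ k : PhaseSpace N g,
      LinearMap.adjoint T * weyl (s.1 *ᵥ k) = weyl k * LinearMap.adjoint T := by
    intro k
    have h := congrArg LinearMap.adjoint (hT (-k))
    rw [Module.End.mul_eq_comp, Module.End.mul_eq_comp, LinearMap.adjoint_comp,
      LinearMap.adjoint_comp, adjoint_weyl hN, adjoint_weyl hN, Matrix.mulVec_neg, neg_neg,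
      neg_neg] at h
    exact h.symm
  obtain ⟨c, hc⟩ := commutant (LinearMap.adjoint T * T) fun k => by
    rw [mul_assoc, hT, ← mul_assoc, hadj, mul_assoc]
  have hin : ∀ f : L2 N g, ((‖T f‖ ^ 2 : ℝ) : ℂ) = c * ((‖f‖ ^ 2 : ℝ) : ℂ) := by
    intro f
    have h := LinearMap.adjoint_inner_right T f (T f)
    have h2 : LinearMap.adjoint T (T f) = c • f := LinearMap.congr_fun hc f
    rw [h2, inner_smul_right, inner_self_eq_norm_sq_to_K, inner_self_eq_norm_sq_to_K] at h
    push_cast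
    exact h.symm
  obtain ⟨f, hf⟩ : ∃ f, T f ≠ 0 := by
    by_contra! h0
    exact hB (LinearMap.ext h0)
  have hf0 : f ≠ 0 := by rintro rfl; simp at hf
  set b : ℝ := ‖T f‖ / ‖f‖
  have hb : 0 < b := div_pos (norm_pos_iff.2 hf) (norm_pos_iff.2 hf0)
  have hcb : c = ((b ^ 2 : ℝ) : ℂ) := by
    have h0 : ((‖f‖ ^ 2 : ℝ) : ℂ) ≠ 0 := by
      have := norm_pos_iff.2 hf0
      exact_mod_cast (pow_pos this 2).ne'
    rw [div_pow, Complex.ofReal_div, eq_div_iff h0]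
    exact (hin f).symm
  have hnorm : ∀ h, ‖T h‖ = b * ‖h‖ := by
    intro h
    have h1 := hin h
    rw [hcb] at h1
    have h2 : ‖T h‖ ^ 2 = (b * ‖h‖) ^ 2 := by rw [mul_pow]; exact_mod_cast h1
    exact (pow_left_inj₀ (norm_nonneg _) (by positivity) two_ne_zero).1 h2
  let U0 : L2 N g →ₗᵢ[ℂ] L2 N g := ⟨((b⁻¹ : ℝ) : ℂ) • T, fun h => by
    rw [LinearMap.smul_apply, norm_smul, hnorm, Complex.norm_real, Real.norm_eq_abs,
      abs_of_pos (inv_pos.2 hb), inv_mul_cancel_left₀ hb.ne']⟩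
  refine ⟨U0.toLinearIsometryEquiv rfl, fun k f => ?_⟩
  change (((b⁻¹ : ℝ) : ℂ) • T) (weyl k f) = weyl (s.1 *ᵥ k) ((((b⁻¹ : ℝ) : ℂ) • T) f)
  rw [LinearMap.smul_apply, LinearMap.smul_apply, map_smul]
  congr 1
  exact LinearMap.congr_fun (hT k) f

/-- A projective unitary representation of a group `G` on a Hilbert space `H`: unitary operators
`ρ s` with `ρ s ∘ ρ t = c(s, t) ρ (s t)` for scalars `c(s, t)` of absolute value one. -/
structure ProjRep (G H : Type*) [Group G] [NormedAddCommGroup H] [InnerProductSpace ℂ H] where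
  toFun : G → (H ≃ₗᵢ[ℂ] H)
  exists_scalar : ∀ s t : G, ∃ c : Circle, ∀ f : H,
    toFun s (toFun t f) = (c : ℂ) • toFun (s * t) f

namespace ProjRep

variable {G G' H H' : Type*} [Group G] [Group G'] [NormedAddCommGroup H] [InnerProductSpace ℂ H]
  [NormedAddCommGroup H'] [InnerProductSpace ℂ H']

/-- Pull-back along a group homomorphism. -/
def comp (ρ : ProjRep G H) (q : G' →* G) : ProjRep G' H where
  toFun s := ρ.toFun (q s)
  exists_scalar s t := by rw [map_mul]; exact ρ.exists_scalar (q s) (q t)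

/-- The subspace `S` is invariant under all operators of `ρ`. -/
def IsInvariant (ρ : ProjRep G H) (S : Submodule ℂ H) : Prop :=
  ∀ s : G, ∀ f ∈ S, ρ.toFun s f ∈ S

theorem toFun_one (ρ : ProjRep G H) : ∃ c : Circle, ∀ f : H, ρ.toFun 1 f = (c : ℂ) • f := by
  obtain ⟨c, hc⟩ := ρ.exists_scalar 1 1
  refine ⟨c, fun f => (ρ.toFun 1).injective ?_⟩
  rw [hc, mul_one, map_smul]

theorem restrict_surjective (ρ : ProjRep G H) (S : Submodule ℂ H) (hS : ρ.IsInvariant S) (s : G)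
    (f : H) (hf : f ∈ S) : ∃ h ∈ S, ρ.toFun s h = f := by
  obtain ⟨c, hc⟩ := ρ.exists_scalar s s⁻¹
  obtain ⟨d, hd⟩ := ρ.toFun_one
  have hcd : (c : ℂ) * d ≠ 0 := mul_ne_zero (Circle.coe_ne_zero c) (Circle.coe_ne_zero d)
  refine ⟨((c : ℂ) * d)⁻¹ • ρ.toFun s⁻¹ f, S.smul_mem _ (hS _ _ hf), ?_⟩
  rw [map_smul, hc, mul_inv_cancel, hd, smul_smul (c : ℂ) (d : ℂ) f, smul_smul,
    inv_mul_cancel₀ hcd, one_smul]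

/-- The restriction of `ρ` to an invariant subspace. -/
def restrict (ρ : ProjRep G H) (S : Submodule ℂ H) (hS : ρ.IsInvariant S) : ProjRep G S where
  toFun s := LinearIsometryEquiv.ofSurjective
    ⟨(ρ.toFun s).toLinearEquiv.toLinearMap.restrict (hS s), fun f => (ρ.toFun s).norm_map f⟩
    fun f => by
      obtain ⟨h, hh, e⟩ := ρ.restrict_surjective S hS s f f.2
      exact ⟨⟨h, hh⟩, Subtype.ext e⟩
  exists_scalar s t := by
    obtain ⟨c, hc⟩ := ρ.exists_scalar s t
    exact ⟨c, fun f => Subtype.ext (hc f)⟩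

theorem restrict_apply (ρ : ProjRep G H) (S : Submodule ℂ H) (hS : ρ.IsInvariant S) (s : G)
    (f : S) : ((ρ.restrict S hS).toFun s f : H) = ρ.toFun s f := rfl

/-- Two projective representations are equivalent if there is an isometry `Φ` of `H` onto `H'`
such that `Φ ∘ ρ s` and `ρ' s ∘ Φ` differ by a constant for each `s`. -/
def Equivalent (ρ : ProjRep G H) (ρ' : ProjRep G H') : Prop :=
  ∃ Φ : H ≃ₗᵢ[ℂ] H', ∀ s : G, ∃ c : Circle, ∀ f : H,
    Φ (ρ.toFun s f) = (c : ℂ) • ρ'.toFun s (Φ f)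

/-- Every element of the subgroup `P` acts by a scalar multiple of the identity. -/
def ActsByScalars (ρ : ProjRep G H) (P : Subgroup G) : Prop :=
  ∀ s ∈ P, ∃ c : ℂ, ∀ f : H, ρ.toFun s f = c • f

end ProjRep

/-- An operator `W(s)` of the Weil representation: a unitary operator, unique up to a scalar,
with `W(s) 𝒲_k W(s)⁻¹ = 𝒲_{s k}` for all `k`. -/
def weilOperator (hN : Odd N) (s : Sp g N) : L2 N g ≃ₗᵢ[ℂ] L2 N g :=
  Classical.choose (exists_intertwiner hN s)

theorem weilOperator_spec (hN : Odd N) (s : Sp g N) (k : PhaseSpace N g) (f : L2 N g) :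
    weilOperator hN s (weyl k f) = weyl (s.1 *ᵥ k) (weilOperator hN s f) :=
  Classical.choose_spec (exists_intertwiner hN s) k f

theorem intertwiner_unique (s : Sp g N) (U U' : L2 N g ≃ₗᵢ[ℂ] L2 N g)
    (hU : ∀ (k : PhaseSpace N g) (f : L2 N g), U (weyl k f) = weyl (s.1 *ᵥ k) (U f))
    (hU' : ∀ (k : PhaseSpace N g) (f : L2 N g), U' (weyl k f) = weyl (s.1 *ᵥ k) (U' f)) :
    ∃ c : Circle, ∀ f, U f = (c : ℂ) • U' f := by
  obtain ⟨c, hc⟩ := commutant (U.trans U'.symm).toLinearEquiv.toLinearMap fun k => by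
    ext1 f
    change U'.symm (U (weyl k f)) = weyl k (U'.symm (U f))
    apply U'.injective
    rw [hU', U'.apply_symm_apply, U'.apply_symm_apply, hU]
  have h1 : ∀ f, U f = c • U' f := fun f => by
    have h : U'.symm (U f) = c • f := LinearMap.congr_fun hc f
    rw [← map_smul, ← h, U'.apply_symm_apply]
  have h2 : ‖c‖ = 1 := by
    have h := congrArg norm (h1 (EuclideanSpace.single 0 1))
    rw [norm_smul, U.norm_map, U'.norm_map] at h
    simpa using h.symm
  exact ⟨⟨c, mem_sphere_zero_iff_norm.2 h2⟩, h1⟩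

variable (g) in
/-- The Weil representation of `Sp_{2g}(ℤ/N)` on `L²((ℤ/N)^g)`, for odd `N`. -/
def weilRep (hN : Odd N) : ProjRep (Sp g N) (L2 N g) where
  toFun s := weilOperator hN s
  exists_scalar s t := by
    refine intertwiner_unique (g := g) (s * t) ((weilOperator hN t).trans (weilOperator hN s)) _
      (fun k f => ?_) (weilOperator_spec hN (s * t))
    change weilOperator hN s (weilOperator hN t (weyl k f)) = weyl ((s.1 * t.1) *ᵥ k)
      (weilOperator hN s (weilOperator hN t f))
    rw [weilOperator_spec, weilOperator_spec, Matrix.mulVec_mulVec]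

/-- The natural map `Sp_{2g}(ℤ/p^n) → Sp_{2g}(ℤ/p^m)` for `m ≤ n`: reduction of all matrix
entries. -/
def reduction (p g : ℕ) {m n : ℕ} (h : m ≤ n) : Sp g (p ^ n) →* Sp g (p ^ m) where
  toFun s := ⟨s.1.map (ZMod.castHom (pow_dvd_pow p h) (ZMod (p ^ m))),
    SymplecticGroup.map_mem s.2 _⟩
  map_one' := Subtype.ext (Matrix.map_one _ (map_zero _) (map_one _))
  map_mul' s t := Subtype.ext (Matrix.map_mul)

/-- `m` is the level of the projective representation `ρ` of `Sp_{2g}(ℤ/p^n)`: the smallest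
`m ≤ n` such that the kernel of reduction modulo `p^m` acts by scalar multiples of the identity. -/
def HasLevel {p g n : ℕ} {H : Type*} [NormedAddCommGroup H] [InnerProductSpace ℂ H]
    (ρ : ProjRep (Sp g (p ^ n)) H) (m : ℕ) : Prop :=
  IsLeast {m : ℕ | ∃ h : m ≤ n, ρ.ActsByScalars (reduction p g h).ker} m

/-- The space `V_{n-2r}` (for `2 r ≤ n`) of functions on `A = (ℤ/p^n)^g` which are supported on
`p^r A` and invariant under translation by `p^(n-r) A`. -/
def V (p n g r : ℕ) [NeZero p] : Submodule ℂ (L2 (p ^ n) g) where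
  carrier := {f | (∀ u : Fin g → ZMod (p ^ n), (¬ ∃ v, u = p ^ r • v) → f u = 0) ∧
    ∀ u v : Fin g → ZMod (p ^ n), f (u + p ^ (n - r) • v) = f u}
  add_mem' := fun {f h} hf hh => ⟨fun u hu => by simp [hf.1 u hu, hh.1 u hu],
    fun u v => by simp only [PiLp.add_apply, hf.2, hh.2]⟩
  zero_mem' := ⟨fun _ _ => rfl, fun _ _ => rfl⟩
  smul_mem' := fun c f hf => ⟨fun u hu => by simp [hf.1 u hu],
    fun u v => by simp only [PiLp.smul_apply, hf.2]⟩

/-- The even functions (`ε = 1`) or the odd functions (`ε = -1`) in `L²(A)`. -/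
def parity (N g : ℕ) [NeZero N] (ε : ℤˣ) : Submodule ℂ (L2 N g) where
  carrier := {f | ∀ u : Fin g → ZMod N, f (-u) = ((ε : ℤ) : ℂ) * f u}
  add_mem' := fun {f h} hf hh u => by simp only [PiLp.add_apply, hf u, hh u, mul_add]
  zero_mem' := fun u => by simp
  smul_mem' := fun c f hf u => by simp only [PiLp.smul_apply, hf u, smul_eq_mul]; ring

/-- `V_{n-2r}^±`: the even or odd functions in `V_{n-2r}`. -/
def Vpm (p n g r : ℕ) [NeZero p] (ε : ℤˣ) : Submodule ℂ (L2 (p ^ n) g) :=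
  V p n g r ⊓ parity (p ^ n) g ε

/-- `U_{n-2r}^±`: the orthogonal complement of `V_{n-2r-2}^±` in `V_{n-2r}^±` if `r < ⌊n/2⌋`, and
all of `V_{n-2r}^±` if `r = ⌊n/2⌋`. -/
def Upm (p n g r : ℕ) [NeZero p] (ε : ℤˣ) : Submodule ℂ (L2 (p ^ n) g) :=
  if r < n / 2 then Vpm p n g r ε ⊓ (Vpm p n g (r + 1) ε)ᗮ else Vpm p n g r ε

end FiniteWeil

end

/-!
The argument rests on three observations about the Weyl operators.

* `V_{n-2r}` is exactly the space of vectors fixed by the Weyl operators attached to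
  `p ^ (n - r) K` (`mem_V_iff`). The symplectic group preserves this subgroup of `K`, so
  `V_{n-2r}` is invariant. Likewise the reflection `f (u) ↦ f (-u)` is proportional to the sum of
  all Weyl operators (`sum_weyl_apply`), hence commutes with `W`. Invariance of `U_{n-2r}^±`
  follows by taking intersections and orthogonal complements.
* The Weyl operators attached to `p ^ r K` preserve `V_{n-2r}`, and under the identification
  `p ^ r v ↦ v` of `p ^ r A / p ^ (n - r) A` with `(ℤ/p^(n-2r))^g` they become the Weyl operators of
  modulus `p ^ (n - 2 r)` (`inflate_weyl`). The identification is isometric up to a factor because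
  the commutant of the Weyl operators consists of scalars. Transporting `W(σ)` along it gives an
  intertwiner for the reduction of `σ`, so uniqueness of intertwiners yields the equivalence
  (`equivalent_restrict_V`). In particular the kernel of reduction modulo `p ^ (n - 2 r)` acts by
  scalars on `V_{n-2r}`, hence on `U_{n-2r}^±`.
* The shear `(x, y) ↦ (x, y + 2 a x_i e_i)` acts, up to a scalar, by multiplication with
  `ψ (a u_i²)`, where `ψ` is the standard character (`exists_weilOperator_shear`). With
  `a = p ^ (n - 2 r - 1)` it lies in the kernel of reduction modulo every `p ^ m`, `m < n - 2 r`.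
  If it acted by a scalar on `U_{n-2r}^±`, the phase would be constant on the union of the supports
  of the functions in `U_{n-2r}^±`. It equals `exp (2 π i / p)` at `p ^ r e_i`, and a second point
  in that union with a different phase is found explicitly: for `n - 2 r ≥ 2` the point
  `p ^ (n - r - 1) e_i`; for `n - 2 r = 1` the origin (even functions), and `2 p ^ r e_i` or
  `p ^ r e_j` with `j ≠ i` (odd functions), of which both fail only if `p = 3` and `g = 1`.
-/

noncomputable section

set_option linter.unusedSectionVars false

namespace FiniteWeil

open Matrix

/-! ### Arithmetic of residue rings of prime power order -/

section Arithmetic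

variable {p n m r g : ℕ}

theorem pow_mul_natCast_ne_zero [Fact p.Prime] {k c : ℕ} (hk : k < n) (hc : ¬ p ∣ c) :
    ((p : ZMod (p ^ n)) ^ k * (c : ZMod (p ^ n))) ≠ 0 := by
  have hp : p.Prime := Fact.out
  intro h
  have h1 : p ^ n ∣ p ^ k * c := by
    rw [← ZMod.natCast_eq_zero_iff]
    exact_mod_cast h
  have h2 : p ^ n ∣ p ^ k :=
    (((Nat.Prime.coprime_iff_not_dvd hp).2 hc).pow_left n).dvd_of_dvd_mul_right h1
  exact absurd ((Nat.pow_dvd_pow_iff_le_right hp.one_lt).1 h2) (by omega)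

theorem natCast_pow_eq_zero {k : ℕ} (hk : n ≤ k) : (p : ZMod (p ^ n)) ^ k = 0 := by
  rw [← Nat.cast_pow, ZMod.natCast_eq_zero_iff]
  exact pow_dvd_pow p hk

theorem exists_eq_pow_mul_of_pow_mul_eq_zero [Fact p.Prime] (hr : r ≤ n) {u : ZMod (p ^ n)}
    (h : (p : ZMod (p ^ n)) ^ (n - r) * u = 0) : ∃ v, u = (p : ZMod (p ^ n)) ^ r * v := by
  have hp : p.Prime := Fact.out
  obtain ⟨a, rfl⟩ := ZMod.intCast_surjective u
  have h1 : ((p ^ n : ℕ) : ℤ) ∣ (p : ℤ) ^ (n - r) * a := by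
    rw [← ZMod.intCast_zmod_eq_zero_iff_dvd]
    exact_mod_cast h
  rw [Nat.cast_pow, show n = (n - r) + r by omega, pow_add, Nat.add_sub_cancel] at h1
  obtain ⟨b, rfl⟩ := Int.dvd_of_mul_dvd_mul_left (pow_ne_zero _ (by exact_mod_cast hp.ne_zero)) h1
  exact ⟨(b : ZMod (p ^ n)), by push_cast; rfl⟩

/-- Multiples `p ^ r a` and `p ^ r b` in `ℤ/p^n` agree up to a multiple of `p ^ (r + m)` exactly
when `a` and `b` agree modulo `p ^ m`. -/
theorem pow_mul_sub_mem_iff [Fact p.Prime] (h : m ≤ n) (hrm : r + m ≤ n) (a b : ZMod (p ^ n)) :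
    (∃ c, (p : ZMod (p ^ n)) ^ r * a = (p : ZMod (p ^ n)) ^ r * b +
      (p : ZMod (p ^ n)) ^ (r + m) * c) ↔
    ZMod.castHom (pow_dvd_pow p h) (ZMod (p ^ m)) a =
      ZMod.castHom (pow_dvd_pow p h) (ZMod (p ^ m)) b := by
  have hp : p.Prime := Fact.out
  have hp0 : (p : ℤ) ≠ 0 := by exact_mod_cast hp.ne_zero
  obtain ⟨a, rfl⟩ := ZMod.intCast_surjective a
  obtain ⟨b, rfl⟩ := ZMod.intCast_surjective b
  rw [map_intCast, map_intCast, ZMod.intCast_eq_intCast_iff_dvd_sub, Nat.cast_pow]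
  constructor
  · rintro ⟨c, hc⟩
    obtain ⟨c, rfl⟩ := ZMod.intCast_surjective c
    have h1 : ((p ^ n : ℕ) : ℤ) ∣ (p : ℤ) ^ r * b + (p : ℤ) ^ (r + m) * c - (p : ℤ) ^ r * a := by
      rw [← ZMod.intCast_eq_intCast_iff_dvd_sub]
      exact_mod_cast hc
    rw [Nat.cast_pow] at h1
    have h2 := (pow_dvd_pow (p : ℤ) hrm).trans h1
    rw [pow_add, mul_assoc, ← mul_add, ← mul_sub] at h2
    have h3 := Int.dvd_of_mul_dvd_mul_left (pow_ne_zero _ hp0) h2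
    have h4 : b - a = (b + p ^ m * c - a) - p ^ m * c := by ring
    rw [h4]
    exact dvd_sub h3 (dvd_mul_right _ _)
  · rintro ⟨c, hc⟩
    refine ⟨((-c : ℤ) : ZMod (p ^ n)), ?_⟩
    have h1 : (p : ℤ) ^ r * a = (p : ℤ) ^ r * b + (p : ℤ) ^ (r + m) * (-c) := by
      rw [pow_add]
      linear_combination (-(p : ℤ) ^ r) * hc
    exact_mod_cast congrArg (Int.cast : ℤ → ZMod (p ^ n)) h1

theorem stdAddChar_pow_mul [NeZero p] (h : m ≤ n) (a : ZMod (p ^ n)) :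
    (ZMod.stdAddChar (N := p ^ n) ((p : ZMod (p ^ n)) ^ (n - m) * a) : ℂ) =
      ZMod.stdAddChar (N := p ^ m) (ZMod.castHom (pow_dvd_pow p h) (ZMod (p ^ m)) a) := by
  obtain ⟨a, rfl⟩ := ZMod.intCast_surjective a
  have e : (p : ZMod (p ^ n)) ^ (n - m) * (a : ZMod (p ^ n)) =
      (((p : ℤ) ^ (n - m) * a : ℤ) : ZMod (p ^ n)) := by push_cast; rfl
  rw [e, map_intCast (ZMod.castHom (pow_dvd_pow p h) (ZMod (p ^ m))), ZMod.stdAddChar_coe,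
    ZMod.stdAddChar_coe]
  congr 1
  have hp : (p : ℂ) ≠ 0 := by exact_mod_cast NeZero.ne p
  have e2 : (p : ℂ) ^ n = p ^ (n - m) * p ^ m := by rw [← pow_add]; congr 1; omega
  push_cast
  rw [e2]
  field_simp

theorem castHom_half [NeZero p] (hp : Odd p) (h : m ≤ n) :
    ZMod.castHom (pow_dvd_pow p h) (ZMod (p ^ m)) (2 : ZMod (p ^ n))⁻¹ = (2 : ZMod (p ^ m))⁻¹ := by
  have h1 := congrArg (ZMod.castHom (pow_dvd_pow p h) (ZMod (p ^ m)))
    (half (hp.pow : Odd (p ^ n)))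
  rw [map_add, map_one] at h1
  have h2 := half (hp.pow : Odd (p ^ m))
  linear_combination (2 : ZMod (p ^ m))⁻¹ * h1 - ZMod.castHom (pow_dvd_pow p h) (ZMod (p ^ m))
    (2 : ZMod (p ^ n))⁻¹ * h2

/-- Reduction of all coordinates of a vector modulo `p ^ m`. -/
def reduceVec {ι : Type*} (h : m ≤ n) (u : ι → ZMod (p ^ n)) : ι → ZMod (p ^ m) :=
  fun i => ZMod.castHom (pow_dvd_pow p h) (ZMod (p ^ m)) (u i)

theorem reduceVec_surjective {ι : Type*} (h : m ≤ n) :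
    Function.Surjective (reduceVec (p := p) h : (ι → ZMod (p ^ n)) → _) := fun w => by
  choose v hv using fun i => ZMod.castHom_surjective (pow_dvd_pow p h) (w i)
  exact ⟨v, funext hv⟩

theorem reduceVec_sub {ι : Type*} (h : m ≤ n) (u v : ι → ZMod (p ^ n)) :
    reduceVec h (u - v) = reduceVec h u - reduceVec h v :=
  funext fun i => map_sub _ (u i) (v i)

theorem reduceVec_dotProduct {ι : Type*} [Fintype ι] (h : m ≤ n) (u v : ι → ZMod (p ^ n)) :
    ZMod.castHom (pow_dvd_pow p h) (ZMod (p ^ m)) (u ⬝ᵥ v) = reduceVec h u ⬝ᵥ reduceVec h v := by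
  simp only [dotProduct, map_sum, map_mul, reduceVec]

theorem pow_smul_apply {ι : Type*} (k : ℕ) (u : ι → ZMod (p ^ n)) (i : ι) :
    (p ^ k • u) i = (p : ZMod (p ^ n)) ^ k * u i := by
  simp [nsmul_eq_mul]

theorem pow_smul_eq_add_iff [Fact p.Prime] (h : m ≤ n) (hrm : r + m ≤ n)
    (u v : Fin g → ZMod (p ^ n)) :
    (∃ w : Fin g → ZMod (p ^ n), p ^ r • u = p ^ r • v + p ^ (r + m) • w) ↔
      reduceVec h u = reduceVec h v := by
  constructor
  · rintro ⟨w, hw⟩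
    refine funext fun i => (pow_mul_sub_mem_iff h hrm (u i) (v i)).1 ⟨w i, ?_⟩
    simpa only [Pi.add_apply, pow_smul_apply] using congrFun hw i
  · intro hw
    choose w hw using fun i => (pow_mul_sub_mem_iff h hrm (u i) (v i)).2 (congrFun hw i)
    refine ⟨w, funext fun i => ?_⟩
    simpa only [Pi.add_apply, pow_smul_apply] using hw i

theorem chi_pow_smul_pow_smul [NeZero p] (j k : ℕ) (hjk : n ≤ j + k)
    (y u : Fin g → ZMod (p ^ n)) : chi (p ^ j • y) (p ^ k • u) = 1 := by
  have : (p ^ j • y) ⬝ᵥ (p ^ k • u) = 0 := by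
    rw [smul_dotProduct, dotProduct_smul, smul_smul, ← pow_add, nsmul_eq_mul, Nat.cast_pow,
      natCast_pow_eq_zero hjk, zero_mul]
  rw [chi, this, AddChar.map_zero_eq_one]

end Arithmetic

/-! ### The spaces `V` as fixed spaces of Weyl operators, and parity -/

section Invariance

variable {p n g r : ℕ} [Fact p.Prime]

/-- `V_{n-2r}` is the space of vectors fixed by all Weyl operators attached to `p ^ (n - r) K`.
As this subgroup of `K` is stable under the symplectic group, `V_{n-2r}` is invariant. -/
theorem mem_V_iff (hr : 2 * r ≤ n) (f : L2 (p ^ n) g) :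
    f ∈ V p n g r ↔ ∀ k : PhaseSpace (p ^ n) g, weyl (p ^ (n - r) • k) f = f := by
  have comp_inl : ∀ k : PhaseSpace (p ^ n) g,
    (p ^ (n - r) • k) ∘ Sum.inl = p ^ (n - r) • (k ∘ Sum.inl) := fun _ => rfl
  have comp_inr : ∀ k : PhaseSpace (p ^ n) g,
    (p ^ (n - r) • k) ∘ Sum.inr = p ^ (n - r) • (k ∘ Sum.inr) := fun _ => rfl
  constructor
  · rintro ⟨hf1, hf2⟩ k
    ext u
    rw [weyl_apply, comp_inl, comp_inr, smul_comm (2 : ZMod (p ^ n))⁻¹,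
      chi_pow_smul_pow_smul _ _ (by omega), one_mul]
    generalize k ∘ (Sum.inl : Fin g → _) = x
    have e : f (u - p ^ (n - r) • x) = f u := by
      have := hf2 u (-x)
      rwa [smul_neg, ← sub_eq_add_neg] at this
    rw [e]
    by_cases hu : ∃ v, u = p ^ r • v
    · obtain ⟨v, rfl⟩ := hu
      have e2 : p ^ r • v - p ^ (n - r) • x = p ^ r • (v - p ^ (n - r - r) • x) := by
        rw [smul_sub, smul_smul, ← pow_add]
        congr 3
        omega
      rw [e2, chi_pow_smul_pow_smul _ _ (by omega), one_mul]
    · rw [hf1 u hu, mul_zero]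
  · intro hf
    constructor
    · intro u hu
      by_contra h0
      apply hu
      have key : ∀ i, ∃ v, u i = (p : ZMod (p ^ n)) ^ r * v := by
        intro i
        apply exists_eq_pow_mul_of_pow_mul_eq_zero (by omega)
        have h := congrArg (fun f : L2 (p ^ n) g => f u) (hf (Sum.elim 0 (Pi.single i 1)))
        simp only [weyl_apply, comp_inl, comp_inr, Sum.elim_comp_inl, Sum.elim_comp_inr] at h
        simp only [smul_zero, sub_zero, chi, dotProduct_zero, AddChar.map_zero_eq_one,
          one_mul] at h
        have h1 := mul_right_cancel₀ h0 (h.trans (one_mul _).symm)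
        rw [← AddChar.map_zero_eq_one (ZMod.stdAddChar (N := p ^ n))] at h1
        have h2 := ZMod.injective_stdAddChar h1
        rwa [smul_dotProduct, single_dotProduct, one_mul, nsmul_eq_mul, Nat.cast_pow] at h2
      choose v hv using key
      exact ⟨v, funext fun i => by rw [hv, pow_smul_apply]⟩
    · intro u v
      have h := congrArg (fun f : L2 (p ^ n) g => f (u + p ^ (n - r) • v))
        (hf (Sum.elim v 0))
      simp only [weyl_apply, comp_inl, comp_inr, Sum.elim_comp_inl, Sum.elim_comp_inr] at h
      simpa [chi] using h.symm

theorem isInvariant_V (hp : Odd p) (hr : 2 * r ≤ n) :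
    (weilRep g (hp.pow : Odd (p ^ n))).IsInvariant (V p n g r) := by
  intro s f hf
  rw [mem_V_iff hr] at hf ⊢
  intro k
  have e : p ^ (n - r) • k = s.1 *ᵥ (p ^ (n - r) • ((s⁻¹).1 *ᵥ k)) := by
    have : s.1 * (s⁻¹).1 = 1 := congrArg Subtype.val (mul_inv_cancel s)
    rw [Matrix.mulVec_smul, Matrix.mulVec_mulVec, this, Matrix.one_mulVec]
  rw [e]
  exact (weilOperator_spec (hp.pow : Odd (p ^ n)) s _ f).symm.trans
    (congrArg (weilOperator (hp.pow : Odd (p ^ n)) s) (hf _))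

end Invariance

section Parity

variable {N g : ℕ} [NeZero N]

/-- The sum of all Weyl operators is a multiple of the reflection `f (u) ↦ f (-u)`. -/
theorem sum_weyl_apply (hN : Odd N) (f : L2 N g) (u : Fin g → ZMod N) :
    (∑ k : PhaseSpace N g, weyl k f) u = (Fintype.card (Fin g → ZMod N) : ℂ) * f (-u) := by
  have hh := half hN
  set t := (2 : ZMod N)⁻¹ with ht
  rw [WithLp.ofLp_sum, Finset.sum_apply]
  simp only [weyl_apply, ← ht]
  rw [← Equiv.sum_comp (Equiv.sumArrowEquivProdArrow (Fin g) (Fin g) (ZMod N)).symm,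
    Fintype.sum_prod_type]
  have e1 : ∀ x y : Fin g → ZMod N,
      chi y (t • x) * (chi y (u - x) * f (u - x)) = chi y (u - t • x) * f (u - x) := by
    intro x y
    rw [← mul_assoc, chi, chi, chi, ← AddChar.map_add_eq_mul, ← dotProduct_add]
    congr 4
    have : x = t • x + t • x := by rw [← add_smul, hh, one_smul]
    nth_rw 2 [this]
    abel
  have e2 : ∀ x : Fin g → ZMod N, ∑ y, chi y (u - t • x) * f (u - x) =
      if x = u + u then (Fintype.card (Fin g → ZMod N) : ℂ) * f (-u) else 0 := by
    intro x
    rw [← Finset.sum_mul]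
    let ψ : AddChar (Fin g → ZMod N) ℂ :=
      { toFun := fun y => chi y (u - t • x)
        map_zero_eq_one' := by simp [chi]
        map_add_eq_mul' := fun a b => by rw [chi, add_dotProduct, AddChar.map_add_eq_mul]; rfl }
    split_ifs with hx
    · subst hx
      have h0 : u - t • (u + u) = 0 := by
        rw [smul_add, ← add_smul, hh, one_smul, sub_self]
      rw [h0]
      simp [chi]
    · have hψ : ψ ≠ 0 := by
        intro h
        apply hx
        have h1 : u - t • x = 0 := by
          ext i
          apply ZMod.injective_stdAddChar
          have := DFunLike.congr_fun h (Pi.single i 1)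
          change chi (Pi.single i 1) (u - t • x) = 1 at this
          rw [Pi.zero_apply, AddChar.map_zero_eq_one, ← this, chi, single_dotProduct, one_mul]
        rw [sub_eq_zero.1 h1, ← add_smul, hh, one_smul]
      have h2 : ∑ y, chi y (u - t • x) = 0 := AddChar.sum_eq_zero_iff_ne_zero.2 hψ
      rw [h2, zero_mul]
  have e3 : ∀ x y : Fin g → ZMod N,
    (Equiv.sumArrowEquivProdArrow (Fin g) (Fin g) (ZMod N)).symm (x, y) = Sum.elim x y :=
    fun _ _ => rfl
  simp only [e3, Sum.elim_comp_inl, Sum.elim_comp_inr, e1, e2]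
  simp

/-- The operators `W(s)` commute with the reflection `f (u) ↦ f (-u)`: conjugation by `W(s)` permutes
the Weyl operators, hence fixes their sum. -/
theorem weilOperator_apply_neg (hN : Odd N) (s : Sp g N) (f h : L2 N g)
    (hfh : ∀ u, h u = f (-u)) (u : Fin g → ZMod N) :
    weilOperator hN s h u = weilOperator hN s f (-u) := by
  have hc : (Fintype.card (Fin g → ZMod N) : ℂ) ≠ 0 := Nat.cast_ne_zero.2 Fintype.card_ne_zero
  have e1 : ∑ k : PhaseSpace N g, weyl k f = (Fintype.card (Fin g → ZMod N) : ℂ) • h := by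
    ext v
    rw [sum_weyl_apply hN, PiLp.smul_apply, smul_eq_mul, hfh]
  have hs : Function.Bijective fun k : PhaseSpace N g => s.1 *ᵥ k := by
    rw [← Finite.injective_iff_bijective]
    intro k l hkl
    have : (s⁻¹).1 * s.1 = 1 := congrArg Subtype.val (inv_mul_cancel s)
    have h2 := congrArg (fun k => (s⁻¹).1 *ᵥ k) hkl
    simpa only [Matrix.mulVec_mulVec, this, Matrix.one_mulVec] using h2
  have e2 := congrArg (weilOperator hN s) e1
  rw [map_sum, map_smul] at e2
  simp only [weilOperator_spec] at e2
  rw [hs.sum_comp fun k => weyl k (weilOperator hN s f)] at e2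
  have e3 := congrArg (fun f : L2 N g => f u) e2
  rw [sum_weyl_apply hN, PiLp.smul_apply, smul_eq_mul] at e3
  exact (mul_left_cancel₀ hc e3).symm

theorem isInvariant_parity (hN : Odd N) (ε : ℤˣ) :
    (weilRep g hN).IsInvariant (parity N g ε) := by
  intro s f hf u
  change weilOperator hN s f (-u) = _ * weilOperator hN s f u
  rw [← weilOperator_apply_neg hN s f (((ε : ℤ) : ℂ) • f) (fun u => (hf u).symm), map_smul]
  rfl

end Parity

section ProjRep

variable {G H : Type*} [Group G] [NormedAddCommGroup H] [InnerProductSpace ℂ H]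

theorem ProjRep.IsInvariant.inf {ρ : ProjRep G H} {S T : Submodule ℂ H}
    (hS : ρ.IsInvariant S) (hT : ρ.IsInvariant T) : ρ.IsInvariant (S ⊓ T) :=
  fun s f hf => ⟨hS s f hf.1, hT s f hf.2⟩

theorem ProjRep.IsInvariant.orthogonal {ρ : ProjRep G H} {S : Submodule ℂ H}
    (hS : ρ.IsInvariant S) : ρ.IsInvariant Sᗮ := by
  intro s f hf
  rw [Submodule.mem_orthogonal] at hf ⊢
  intro h hh
  obtain ⟨h', hh', rfl⟩ := ρ.restrict_surjective S hS s h hh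
  rw [LinearIsometryEquiv.inner_map_map]
  exact hf h' hh'

end ProjRep

theorem isInvariant_Upm {p n g r : ℕ} [Fact p.Prime] (hp : Odd p) (hr : r ≤ n / 2) (ε : ℤˣ) :
    (weilRep g (hp.pow : Odd (p ^ n))).IsInvariant (Upm p n g r ε) := by
  have h1 : (weilRep g (hp.pow : Odd (p ^ n))).IsInvariant (Vpm p n g r ε) :=
    (isInvariant_V hp (by omega)).inf (isInvariant_parity _ ε)
  unfold Upm
  split_ifs with h
  · have h2 : (weilRep g (hp.pow : Odd (p ^ n))).IsInvariant (Vpm p n g (r + 1) ε) :=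
      (isInvariant_V hp (by omega)).inf (isInvariant_parity _ ε)
    exact h1.inf h2.orthogonal
  · exact h1

/-! ### The equivalence of `V` with the Weil representation of smaller modulus -/

theorem norm_sq_map_of_adjoint_comp_self {H H' : Type*} [NormedAddCommGroup H]
    [InnerProductSpace ℂ H] [FiniteDimensional ℂ H] [NormedAddCommGroup H']
    [InnerProductSpace ℂ H'] [FiniteDimensional ℂ H'] (T : H →ₗ[ℂ] H') {c : ℂ}
    (hc : LinearMap.adjoint T ∘ₗ T = c • LinearMap.id) (f : H) :
    ((‖T f‖ ^ 2 : ℝ) : ℂ) = c * ((‖f‖ ^ 2 : ℝ) : ℂ) := by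
  have h := LinearMap.adjoint_inner_right T f (T f)
  have h2 : LinearMap.adjoint T (T f) = c • f := LinearMap.congr_fun hc f
  rw [h2, inner_smul_right, inner_self_eq_norm_sq_to_K, inner_self_eq_norm_sq_to_K] at h
  push_cast
  exact h.symm

section Inflation

variable {p n g r : ℕ} [Fact p.Prime]

variable (p n g r) in
/-- The map `L²((ℤ/p^(n-2r))^g) → L²((ℤ/p^n)^g)` sending `f` to the function `p^r v ↦ f (v̄)`,
extended by zero, where `v̄` is the reduction of `v`. -/
def inflate : L2 (p ^ (n - 2 * r)) g →ₗ[ℂ] L2 (p ^ n) g where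
  toFun f := WithLp.toLp 2 fun u => open Classical in
    if h : ∃ v, u = p ^ r • v then f (reduceVec (Nat.sub_le n (2 * r)) h.choose) else 0
  map_add' f h := by
    ext u
    by_cases hu : ∃ v, u = p ^ r • v <;>
      simp only [hu, dite_true, dite_false, PiLp.add_apply, add_zero]
  map_smul' c f := by
    ext u
    by_cases hu : ∃ v, u = p ^ r • v <;>
      simp only [hu, dite_true, dite_false, PiLp.smul_apply, RingHom.id_apply, smul_zero]

theorem inflate_apply_pow_smul (hr : 2 * r ≤ n) (f : L2 (p ^ (n - 2 * r)) g)
    (v : Fin g → ZMod (p ^ n)) :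
    inflate p n g r f (p ^ r • v) = f (reduceVec (Nat.sub_le n (2 * r)) v) := by
  have h : ∃ w, p ^ r • v = p ^ r • w := ⟨v, rfl⟩
  have h1 : inflate p n g r f (p ^ r • v) = f (reduceVec (Nat.sub_le n (2 * r)) h.choose) :=
    dif_pos h
  rw [h1, (pow_smul_eq_add_iff (r := r) (Nat.sub_le n (2 * r)) (by omega) v h.choose).1
    ⟨0, by rw [smul_zero, add_zero]; exact h.choose_spec⟩]

theorem inflate_apply_of_not_exists (f : L2 (p ^ (n - 2 * r)) g) (u : Fin g → ZMod (p ^ n))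
    (hu : ¬ ∃ v, u = p ^ r • v) : inflate p n g r f u = 0 :=
  dif_neg hu

theorem chi_pow_smul (hr : 2 * r ≤ n) (y u : Fin g → ZMod (p ^ n)) :
    chi (p ^ r • y) (p ^ r • u) =
      chi (reduceVec (Nat.sub_le n (2 * r)) y) (reduceVec (Nat.sub_le n (2 * r)) u) := by
  rw [chi, chi, ← reduceVec_dotProduct, ← stdAddChar_pow_mul (Nat.sub_le n (2 * r)),
    smul_dotProduct, dotProduct_smul, smul_smul, ← pow_add, nsmul_eq_mul, Nat.cast_pow]
  congr 3
  omega

theorem inflate_weyl (hp : Odd p) (hr : 2 * r ≤ n) (k : PhaseSpace (p ^ n) g)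
    (f : L2 (p ^ (n - 2 * r)) g) :
    inflate p n g r (weyl (reduceVec (Nat.sub_le n (2 * r)) k) f) =
      weyl (p ^ r • k) (inflate p n g r f) := by
  have e1 : (p ^ r • k) ∘ Sum.inl = p ^ r • (k ∘ Sum.inl) := rfl
  have e2 : (p ^ r • k) ∘ Sum.inr = p ^ r • (k ∘ Sum.inr) := rfl
  have e3 : reduceVec (Nat.sub_le n (2 * r)) k ∘ Sum.inl =
    reduceVec (Nat.sub_le n (2 * r)) (k ∘ Sum.inl) := rfl
  have e4 : reduceVec (Nat.sub_le n (2 * r)) k ∘ Sum.inr =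
    reduceVec (Nat.sub_le n (2 * r)) (k ∘ Sum.inr) := rfl
  ext u
  rw [weyl_apply, e1, e2]
  generalize hx : k ∘ (Sum.inl : Fin g → _) = x at *
  generalize hy : k ∘ (Sum.inr : Fin g → _) = y at *
  by_cases hu : ∃ v, u = p ^ r • v
  · obtain ⟨v, rfl⟩ := hu
    have e5 : (2 : ZMod (p ^ (n - 2 * r)))⁻¹ • reduceVec (Nat.sub_le n (2 * r)) x =
        reduceVec (Nat.sub_le n (2 * r)) ((2 : ZMod (p ^ n))⁻¹ • x) := by
      ext i
      simp only [reduceVec, Pi.smul_apply, smul_eq_mul, map_mul,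
        castHom_half hp (Nat.sub_le n (2 * r))]
    rw [inflate_apply_pow_smul hr, weyl_apply, e3, e4, e5, smul_comm (2 : ZMod (p ^ n))⁻¹,
      ← smul_sub, chi_pow_smul hr, chi_pow_smul hr, inflate_apply_pow_smul hr, reduceVec_sub]
  · have hu' : ¬ ∃ v, u - p ^ r • x = p ^ r • v := by
      rintro ⟨v, hv⟩
      exact hu ⟨v + x, by rw [smul_add, ← hv, sub_add_cancel]⟩
    rw [inflate_apply_of_not_exists _ _ hu, inflate_apply_of_not_exists _ _ hu', mul_zero,
      mul_zero]

theorem inflate_mem_V (hr : 2 * r ≤ n) (f : L2 (p ^ (n - 2 * r)) g) :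
    inflate p n g r f ∈ V p n g r := by
  refine ⟨inflate_apply_of_not_exists f, fun u v => ?_⟩
  have e : p ^ (n - r) • v = p ^ r • (p ^ (n - 2 * r) • v) := by
    rw [smul_smul, ← pow_add]; congr 2; omega
  by_cases hu : ∃ w, u = p ^ r • w
  · obtain ⟨w, rfl⟩ := hu
    rw [e, ← smul_add, inflate_apply_pow_smul hr, inflate_apply_pow_smul hr,
      (pow_smul_eq_add_iff (r := r) (Nat.sub_le n (2 * r)) (by omega) _ w).1
        ⟨v, by rw [smul_add, smul_smul, ← pow_add]⟩]
  · have hu' : ¬ ∃ w, u + p ^ (n - r) • v = p ^ r • w := by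
      rintro ⟨w, hw⟩
      exact hu ⟨w - p ^ (n - 2 * r) • v, by rw [smul_sub, ← hw, ← e, add_sub_cancel_right]⟩
    rw [inflate_apply_of_not_exists _ _ hu, inflate_apply_of_not_exists _ _ hu']

theorem exists_inflate_eq (hr : 2 * r ≤ n) {f : L2 (p ^ n) g} (hf : f ∈ V p n g r) :
    ∃ h, inflate p n g r h = f := by
  have hs := reduceVec_surjective (p := p) (ι := Fin g) (Nat.sub_le n (2 * r))
  refine ⟨WithLp.toLp 2 fun w => f (p ^ r • (hs w).choose), ?_⟩
  ext u
  by_cases hu : ∃ v, u = p ^ r • v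
  · obtain ⟨v, rfl⟩ := hu
    rw [inflate_apply_pow_smul hr]
    change f (p ^ r • (hs _).choose) = _
    obtain ⟨w, hw⟩ := (pow_smul_eq_add_iff (r := r) (Nat.sub_le n (2 * r)) (by omega) _ v).2
      (hs (reduceVec (Nat.sub_le n (2 * r)) v)).choose_spec
    rw [hw, show r + (n - 2 * r) = n - r by omega]
    exact hf.2 _ _
  · rw [inflate_apply_of_not_exists _ _ hu, hf.1 u hu]

/-- Inflation is a multiple of an isometry: `inflate* ∘ inflate` commutes with the Weyl operators
of `(ℤ/p^(n-2r))^g`, hence is a scalar. -/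
theorem exists_norm_inflate (hp : Odd p) (hr : 2 * r ≤ n) :
    ∃ b : ℝ, 0 < b ∧ ∀ f, ‖inflate p n g r f‖ = b * ‖f‖ := by
  have hN : Odd (p ^ (n - 2 * r)) := hp.pow
  have hN' : Odd (p ^ n) := hp.pow
  have hint : ∀ k : PhaseSpace (p ^ n) g,
      inflate p n g r ∘ₗ weyl (reduceVec (Nat.sub_le n (2 * r)) k) =
        weyl (p ^ r • k) ∘ₗ inflate p n g r := fun k => LinearMap.ext fun f =>
    inflate_weyl hp hr k f
  have hadj : ∀ k : PhaseSpace (p ^ n) g,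
      weyl (reduceVec (Nat.sub_le n (2 * r)) k) ∘ₗ LinearMap.adjoint (inflate p n g r) =
        LinearMap.adjoint (inflate p n g r) ∘ₗ weyl (p ^ r • k) := by
    intro k
    have h := congrArg LinearMap.adjoint (hint (-k))
    have e : reduceVec (p := p) (Nat.sub_le n (2 * r)) (-k) =
        -reduceVec (Nat.sub_le n (2 * r)) k := funext fun i => map_neg _ (k i)
    rw [LinearMap.adjoint_comp, LinearMap.adjoint_comp, adjoint_weyl hN, adjoint_weyl hN', e,
      smul_neg, neg_neg, neg_neg] at h
    exact h
  obtain ⟨c, hc⟩ := commutant (LinearMap.adjoint (inflate p n g r) ∘ₗ inflate p n g r) fun k => by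
    obtain ⟨k, rfl⟩ := reduceVec_surjective (p := p) (Nat.sub_le n (2 * r)) k
    rw [Module.End.mul_eq_comp, Module.End.mul_eq_comp, LinearMap.comp_assoc, hint,
      ← LinearMap.comp_assoc, ← hadj, LinearMap.comp_assoc]
  have hin : ∀ f : L2 (p ^ (n - 2 * r)) g,
      ((‖inflate p n g r f‖ ^ 2 : ℝ) : ℂ) = c * ((‖f‖ ^ 2 : ℝ) : ℂ) :=
    norm_sq_map_of_adjoint_comp_self _ hc
  set d : L2 (p ^ (n - 2 * r)) g := EuclideanSpace.single 0 1 with hd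
  have hd1 : ‖d‖ = 1 := by simp [hd]
  have hd2 : inflate p n g r d ≠ 0 := by
    intro h0
    have h := inflate_apply_pow_smul hr d 0
    have e : reduceVec (p := p) (Nat.sub_le n (2 * r)) (0 : Fin g → ZMod (p ^ n)) = 0 :=
      funext fun i => map_zero _
    rw [h0, e] at h
    simp [hd] at h
  refine ⟨‖inflate p n g r d‖, norm_pos_iff.2 hd2, fun f => ?_⟩
  have hcd := hin d
  rw [hd1] at hcd
  norm_num at hcd
  have h1 := hin f
  rw [← hcd] at h1
  have h2 : ‖inflate p n g r f‖ ^ 2 = (‖inflate p n g r d‖ * ‖f‖) ^ 2 := by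
    rw [mul_pow]; exact_mod_cast h1
  exact (pow_left_inj₀ (norm_nonneg _) (by positivity) two_ne_zero).1 h2

/-- The normalised inflation map is a unitary map onto `V`. -/
theorem exists_inflate_isometry (hp : Odd p) (hr : 2 * r ≤ n) :
    ∃ (Φ : L2 (p ^ (n - 2 * r)) g ≃ₗᵢ[ℂ] V p n g r) (b : ℂ),
      ∀ f, (Φ f : L2 (p ^ n) g) = b • inflate p n g r f := by
  obtain ⟨b, hb, hn⟩ := exists_norm_inflate (p := p) (n := n) (g := g) (r := r) hp hr
  have hb0 : (b : ℂ) ≠ 0 := by exact_mod_cast hb.ne'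
  let Ψ : L2 (p ^ (n - 2 * r)) g →ₗ[ℂ] V p n g r :=
    (((b : ℂ)⁻¹) • inflate p n g r).codRestrict _
      fun f => Submodule.smul_mem _ _ (inflate_mem_V hr f)
  refine ⟨LinearIsometryEquiv.ofSurjective ⟨Ψ, fun f => ?_⟩ fun f => ?_, (b : ℂ)⁻¹, fun f => rfl⟩
  · change ‖(b : ℂ)⁻¹ • inflate p n g r f‖ = _
    rw [norm_smul, hn, norm_inv, Complex.norm_real, Real.norm_eq_abs, abs_of_pos hb,
      inv_mul_cancel_left₀ hb.ne']
  · obtain ⟨h, hh⟩ := exists_inflate_eq hr f.2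
    refine ⟨(b : ℂ) • h, Subtype.ext ?_⟩
    change (b : ℂ)⁻¹ • inflate p n g r ((b : ℂ) • h) = _
    rw [map_smul, inv_smul_smul₀ hb0, hh]

theorem equivalent_restrict_V (hp : Odd p) (hr : 2 * r ≤ n)
    (hV : (weilRep g (hp.pow : Odd (p ^ n))).IsInvariant (V p n g r)) :
    ((weilRep g (hp.pow : Odd (p ^ (n - 2 * r)))).comp
      (reduction p g (Nat.sub_le n (2 * r)))).Equivalent
        ((weilRep g (hp.pow : Odd (p ^ n))).restrict (V p n g r) hV) := by
  obtain ⟨Φ, b, hΦ⟩ := exists_inflate_isometry (p := p) (n := n) (g := g) (r := r) hp hr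
  refine ⟨Φ, fun s => ?_⟩
  set R := (weilRep g (hp.pow : Odd (p ^ n))).restrict (V p n g r) hV with hR
  set s' := reduction p g (Nat.sub_le n (2 * r)) s with hs'
  -- Transport `W s` to `L²((ℤ/p^(n-2r))^g)`; the result intertwines the Weyl operators like `W s'`.
  obtain ⟨c, hc⟩ := intertwiner_unique s' (weilOperator (hp.pow : Odd (p ^ (n - 2 * r))) s')
    ((Φ.trans (R.toFun s)).trans Φ.symm) (weilOperator_spec _ s') (fun k f => by
      obtain ⟨k, rfl⟩ := reduceVec_surjective (p := p) (Nat.sub_le n (2 * r)) k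
      have e : s'.1 *ᵥ reduceVec (Nat.sub_le n (2 * r)) k =
          reduceVec (Nat.sub_le n (2 * r)) (s.1 *ᵥ k) := by
        ext i
        exact (RingHom.map_mulVec _ s.1 k i).symm
      have hΦw : ∀ (l : PhaseSpace (p ^ n) g) (h : L2 (p ^ (n - 2 * r)) g),
          (Φ (weyl (reduceVec (Nat.sub_le n (2 * r)) l) h) : L2 (p ^ n) g) =
            weyl (p ^ r • l) (Φ h) := fun l h => by
        rw [hΦ, hΦ, inflate_weyl hp hr, map_smul]
      rw [e]
      apply Φ.injective
      apply Subtype.ext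
      rw [hΦw]
      simp only [LinearIsometryEquiv.trans_apply, LinearIsometryEquiv.apply_symm_apply]
      change weilOperator (hp.pow : Odd (p ^ n)) s (Φ _ : L2 (p ^ n) g) =
        weyl _ (weilOperator (hp.pow : Odd (p ^ n)) s (Φ f : L2 (p ^ n) g))
      rw [hΦw, weilOperator_spec, Matrix.mulVec_smul])
  refine ⟨c, fun f => ?_⟩
  change Φ (weilOperator (hp.pow : Odd (p ^ (n - 2 * r))) s' f) = _
  rw [hc, map_smul]
  simp

/-- The elements in the kernel of `q` act by scalars on `V_{n-2r}`, where `W` is equivalent to a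
pull-back along `q`, and `U_{n-2r}^±` is contained in `V_{n-2r}`. -/
theorem actsByScalars_restrict_Upm (hp : Odd p) (hr : r ≤ n / 2) (ε : ℤˣ)
    (hU : (weilRep g (hp.pow : Odd (p ^ n))).IsInvariant (Upm p n g r ε)) :
    ((weilRep g (hp.pow : Odd (p ^ n))).restrict (Upm p n g r ε) hU).ActsByScalars
      (reduction p g (Nat.sub_le n (2 * r))).ker := by
  have hV := isInvariant_V (g := g) hp (show 2 * r ≤ n by omega)
  obtain ⟨Φ, hΦ⟩ := equivalent_restrict_V hp (by omega) hV
  intro s hs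
  obtain ⟨c, hc⟩ := hΦ s
  obtain ⟨d, hd⟩ := (weilRep g (hp.pow : Odd (p ^ (n - 2 * r)))).toFun_one
  refine ⟨(c : ℂ)⁻¹ * d, fun f => Subtype.ext ?_⟩
  have hfV : (f : L2 (p ^ n) g) ∈ V p n g r := by
    have := f.2
    unfold Upm at this
    split_ifs at this
    · exact this.1.1
    · exact this.1
  have h := hc (Φ.symm ⟨f, hfV⟩)
  change Φ ((weilRep g (hp.pow : Odd (p ^ (n - 2 * r)))).toFun
    (reduction p g (Nat.sub_le n (2 * r)) s) _) = _ at h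
  rw [MonoidHom.mem_ker.1 hs, hd, map_smul, LinearIsometryEquiv.apply_symm_apply] at h
  have h2 := congrArg Subtype.val h
  change (weilRep g (hp.pow : Odd (p ^ n))).toFun s (f : L2 (p ^ n) g) =
    ((c : ℂ)⁻¹ * d) • (f : L2 (p ^ n) g)
  rw [mul_smul, ← show (d : ℂ) • (f : L2 (p ^ n) g) = _ from rfl]
  change (d : ℂ) • (f : L2 (p ^ n) g) =
    (c : ℂ) • (weilRep g (hp.pow : Odd (p ^ n))).toFun s (f : L2 (p ^ n) g) at h2
  rw [h2, inv_smul_smul₀ (Circle.coe_ne_zero c)]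

end Inflation

/-! ### Shears acting by quadratic phases -/

section Shear

variable {N g : ℕ} [NeZero N]

/-- The shear `(x, y) ↦ (x, y + 2 a x_i e_i)`. -/
def shear (i : Fin g) (a : ZMod N) : Sp g N :=
  ⟨Matrix.fromBlocks 1 0 (Matrix.single i i (2 * a)) 1, by
    rw [SymplecticGroup.mem_iff]
    simp [J, Matrix.fromBlocks_transpose, Matrix.fromBlocks_multiply]⟩

theorem shear_mulVec (i : Fin g) (a : ZMod N) (k : PhaseSpace N g) :
    (shear i a).1 *ᵥ k =
      Sum.elim (k ∘ Sum.inl) (k ∘ Sum.inr + Pi.single i (2 * a * k (Sum.inl i))) := by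
  change Matrix.fromBlocks 1 0 (Matrix.single i i (2 * a)) 1 *ᵥ k = _
  rw [Matrix.fromBlocks_mulVec]
  ext j
  cases j with
  | inl j => simp
  | inr j =>
    simp only [Sum.elim_inr, Pi.add_apply, Matrix.one_mulVec, Function.comp_apply,
      Matrix.single_mulVec]
    rw [add_comm]
    by_cases h : j = i
    · subst h; simp
    · simp [h]

/-- Multiplication by the quadratic phase `ψ (a u_i²)`, where `ψ` is the standard character. -/
def quadraticPhase (i : Fin g) (a : ZMod N) : L2 N g ≃ₗᵢ[ℂ] L2 N g where
  toFun f := WithLp.toLp 2 fun u => ZMod.stdAddChar (a * u i ^ 2) * f u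
  invFun f := WithLp.toLp 2 fun u => ZMod.stdAddChar (-(a * u i ^ 2)) * f u
  map_add' f h := by ext u; simp [mul_add]
  map_smul' c f := by ext u; simp [mul_left_comm]
  left_inv f := by ext u; simp [← mul_assoc, ← AddChar.map_add_eq_mul]
  right_inv f := by ext u; simp [← mul_assoc, ← AddChar.map_add_eq_mul]
  norm_map' f := by
    have hc : ∀ x : ZMod N, ‖(ZMod.stdAddChar x : ℂ)‖ = 1 := fun x => by
      rw [ZMod.stdAddChar_apply]; exact Circle.norm_coe _
    rw [EuclideanSpace.norm_eq, EuclideanSpace.norm_eq]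
    congr 1
    refine Finset.sum_congr rfl fun u _ => ?_
    change ‖ZMod.stdAddChar (a * u i ^ 2) * f u‖ ^ 2 = _
    rw [norm_mul, hc, one_mul]

theorem quadraticPhase_apply (i : Fin g) (a : ZMod N) (f : L2 N g) (u : Fin g → ZMod N) :
    quadraticPhase i a f u = ZMod.stdAddChar (a * u i ^ 2) * f u := rfl

theorem quadraticPhase_weyl (hN : Odd N) (i : Fin g) (a : ZMod N) (k : PhaseSpace N g)
    (f : L2 N g) :
    quadraticPhase i a (weyl k f) = weyl ((shear i a).1 *ᵥ k) (quadraticPhase i a f) := by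
  have hh := half hN
  ext u
  rw [shear_mulVec, quadraticPhase_apply, weyl_apply, weyl_apply, quadraticPhase_apply,
    Sum.elim_comp_inl, Sum.elim_comp_inr]
  set t := (2 : ZMod N)⁻¹ with ht
  have hx : k (Sum.inl i) = (k ∘ Sum.inl) i := rfl
  rw [hx]
  generalize k ∘ (Sum.inl : Fin g → _) = x
  generalize k ∘ (Sum.inr : Fin g → _) = y
  simp only [chi, ← mul_assoc, ← AddChar.map_add_eq_mul]
  congr 2
  simp only [add_dotProduct, single_dotProduct, Pi.sub_apply, Pi.smul_apply, smul_eq_mul]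
  linear_combination (-a * x i ^ 2) * hh

/-- The Weil representation maps a shear to a multiple of a quadratic phase. -/
theorem exists_weilOperator_shear (hN : Odd N) (i : Fin g) (a : ZMod N) :
    ∃ c : Circle, ∀ f, quadraticPhase i a f = (c : ℂ) • weilOperator hN (shear i a) f :=
  intertwiner_unique (shear i a) _ _ (quadraticPhase_weyl hN i a) (weilOperator_spec hN _)

end Shear

section Level

variable {p n g r : ℕ} [Fact p.Prime]

theorem shear_mem_ker {m j : ℕ} (h : m ≤ n) (hj : m ≤ j) (i : Fin g) :
    shear i ((p : ZMod (p ^ n)) ^ j) ∈ (reduction p g h).ker := by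
  rw [MonoidHom.mem_ker]
  apply Subtype.ext
  change (Matrix.fromBlocks 1 0 (Matrix.single i i (2 * (p : ZMod (p ^ n)) ^ j)) 1).map
    (ZMod.castHom (pow_dvd_pow p h) (ZMod (p ^ m))) = 1
  rw [Matrix.fromBlocks_map, Matrix.map_single, map_mul, map_pow, map_natCast,
    natCast_pow_eq_zero hj]
  rw [Matrix.map_one _ (map_zero _) (map_one _), Matrix.map_zero _ (map_zero _), mul_zero,
    Matrix.single_zero, Matrix.fromBlocks_one]

/-- If `N_m` acts by scalars on an invariant subspace, then a quadratic phase attached to a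
shear in `N_m` takes the same value at all points where some function of the subspace does not
vanish. -/
theorem quadratic_eq_of_actsByScalars (hp : Odd p) {S : Submodule ℂ (L2 (p ^ n) g)}
    (hS : (weilRep g (hp.pow : Odd (p ^ n))).IsInvariant S) {m j : ℕ} (hm : m ≤ n) (hj : m ≤ j)
    (hs : ((weilRep g (hp.pow : Odd (p ^ n))).restrict S hS).ActsByScalars
      (reduction p g hm).ker) (i : Fin g) {f f' : L2 (p ^ n) g} (hf : f ∈ S) (hf' : f' ∈ S)
    {u u' : Fin g → ZMod (p ^ n)} (hu : f u ≠ 0) (hu' : f' u' ≠ 0) :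
    (p : ZMod (p ^ n)) ^ j * u i ^ 2 = (p : ZMod (p ^ n)) ^ j * u' i ^ 2 := by
  obtain ⟨c, hc⟩ := hs _ (shear_mem_ker hm hj i)
  obtain ⟨d, hd⟩ := exists_weilOperator_shear (hp.pow : Odd (p ^ n)) i ((p : ZMod (p ^ n)) ^ j)
  have key : ∀ {h : L2 (p ^ n) g} (_ : h ∈ S) {w : Fin g → ZMod (p ^ n)} (_ : h w ≠ 0),
      ZMod.stdAddChar ((p : ZMod (p ^ n)) ^ j * w i ^ 2) = d * c := by
    intro h hh w hw
    have h1 : weilOperator (hp.pow : Odd (p ^ n)) (shear i ((p : ZMod (p ^ n)) ^ j)) h = c • h :=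
      congrArg Subtype.val (hc ⟨h, hh⟩)
    have h2 := congrArg (fun f : L2 (p ^ n) g => f w) (hd h)
    simp only [quadraticPhase_apply, h1, PiLp.smul_apply, smul_eq_mul] at h2
    rw [← mul_assoc] at h2
    exact mul_right_cancel₀ hw h2
  exact ZMod.injective_stdAddChar ((key hf hu).trans (key hf' hu').symm)

/-! ### Test functions in `U` -/

variable (p n g r) in
/-- The indicator function of the coset `z + p ^ (n - r) A`. -/
def cosetIndicator (z : Fin g → ZMod (p ^ n)) : L2 (p ^ n) g :=
  WithLp.toLp 2 fun u => open Classical in if ∃ v, u = z + p ^ (n - r) • v then 1 else 0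

theorem cosetIndicator_apply_add (z u v : Fin g → ZMod (p ^ n)) :
    cosetIndicator p n g r z (u + p ^ (n - r) • v) = cosetIndicator p n g r z u := by
  have : (∃ w, u + p ^ (n - r) • v = z + p ^ (n - r) • w) ↔ ∃ w, u = z + p ^ (n - r) • w :=
    ⟨fun ⟨w, hw⟩ => ⟨w - v, by rw [smul_sub, ← add_sub_assoc, ← hw, add_sub_cancel_right]⟩,
      fun ⟨w, hw⟩ => ⟨w + v, by rw [smul_add, ← add_assoc, hw]⟩⟩
  simp only [cosetIndicator, this]

theorem cosetIndicator_apply_neg (z u : Fin g → ZMod (p ^ n)) :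
    cosetIndicator p n g r z (-u) = cosetIndicator p n g r (-z) u := by
  have : (∃ w, -u = z + p ^ (n - r) • w) ↔ ∃ w, u = -z + p ^ (n - r) • w :=
    ⟨fun ⟨w, hw⟩ => ⟨-w, by rw [smul_neg, ← neg_add, ← hw, neg_neg]⟩,
      fun ⟨w, hw⟩ => ⟨-w, by rw [hw, smul_neg, neg_add, neg_neg]⟩⟩
  simp only [cosetIndicator, this]

theorem cosetIndicator_apply_self (z : Fin g → ZMod (p ^ n)) :
    cosetIndicator p n g r z z = 1 :=
  if_pos ⟨0, by simp⟩

theorem cosetIndicator_eq_zero {z u : Fin g → ZMod (p ^ n)} (i : Fin g) (hr : r ≤ n)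
    (h : (p : ZMod (p ^ n)) ^ r * (u i - z i) ≠ 0) : cosetIndicator p n g r z u = 0 := by
  refine if_neg ?_
  rintro ⟨v, rfl⟩
  apply h
  rw [Pi.add_apply, add_sub_cancel_left, pow_smul_apply, ← mul_assoc, ← pow_add,
    natCast_pow_eq_zero (by omega), zero_mul]

theorem cosetIndicator_mem_V (hr : 2 * r ≤ n) (z : Fin g → ZMod (p ^ n)) :
    cosetIndicator p n g r (p ^ r • z) ∈ V p n g r := by
  refine ⟨fun u hu => if_neg ?_, cosetIndicator_apply_add _⟩
  rintro ⟨v, rfl⟩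
  refine hu ⟨z + p ^ (n - r - r) • v, ?_⟩
  rw [smul_add, smul_smul, ← pow_add]
  congr 3
  omega

/-- Pairing with a coset indicator evaluates functions invariant under `p ^ (n - r) A`, up to the
number of elements of the coset. -/
theorem inner_cosetIndicator {h : L2 (p ^ n) g}
    (hh : ∀ u v : Fin g → ZMod (p ^ n), h (u + p ^ (n - r) • v) = h u)
    (z : Fin g → ZMod (p ^ n)) :
    inner ℂ (cosetIndicator p n g r z) h = (∑ u, cosetIndicator p n g r 0 u) * h z := by
  have e1 : ∀ u, inner ℂ (cosetIndicator p n g r z u) (h u) =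
      cosetIndicator p n g r 0 (u - z) * h z := by
    intro u
    have e2 : (∃ v, u - z = 0 + p ^ (n - r) • v) ↔ ∃ v, u = z + p ^ (n - r) • v := by
      simp only [zero_add, sub_eq_iff_eq_add']
    simp only [cosetIndicator, e2]
    by_cases hu : ∃ v, u = z + p ^ (n - r) • v
    · rw [if_pos hu]
      obtain ⟨v, rfl⟩ := hu
      rw [hh]
      simp
    · rw [if_neg hu]
      simp
  rw [PiLp.inner_apply]
  simp only [e1]
  rw [← Finset.sum_mul]
  congr 1
  exact Equiv.sum_comp (Equiv.subRight z) (cosetIndicator p n g r (0 : Fin g → ZMod (p ^ n)))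

variable (p n g r) in
/-- The function `δ_z + ε δ_{-z} - b δ_0`, where `δ_z` is the indicator of `z + p ^ (n - r) A`. -/
def testFunction (ε : ℤˣ) (b : ℂ) (z : Fin g → ZMod (p ^ n)) : L2 (p ^ n) g :=
  cosetIndicator p n g r z + ((ε : ℤ) : ℂ) • cosetIndicator p n g r (-z) -
    b • cosetIndicator p n g r 0

theorem testFunction_mem_Vpm (hr : 2 * r ≤ n) {ε : ℤˣ} {b : ℂ} (hb : ((ε : ℤ) : ℂ) * b = b)
    (z : Fin g → ZMod (p ^ n)) :
    testFunction p n g r ε b (p ^ r • z) ∈ Vpm p n g r ε := by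
  refine ⟨sub_mem (add_mem (cosetIndicator_mem_V hr z) (Submodule.smul_mem _ _ ?_))
    (Submodule.smul_mem _ _ ?_), fun u => ?_⟩
  · rw [← smul_neg]
    exact cosetIndicator_mem_V hr _
  · have := cosetIndicator_mem_V hr (0 : Fin g → ZMod (p ^ n))
    rwa [smul_zero] at this
  · have hε : ((ε : ℤ) : ℂ) * ((ε : ℤ) : ℂ) = 1 := by
      rcases Int.units_eq_one_or ε with rfl | rfl <;> simp
    simp only [testFunction, PiLp.sub_apply, PiLp.add_apply, PiLp.smul_apply,
      cosetIndicator_apply_neg, neg_neg, neg_zero, smul_eq_mul]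
    linear_combination (-cosetIndicator p n g r (-(p ^ r • z)) u) * hε +
      cosetIndicator p n g r 0 u * hb

/-- Orthogonality of a test function to `V_{n-2r-2}^±` amounts to a linear relation between the
values at `z`, `-z` and `0` of the functions in that space. -/
theorem testFunction_mem_Upm (hr : r ≤ n / 2) {ε : ℤˣ} {b : ℂ} (hb : ((ε : ℤ) : ℂ) * b = b)
    (z : Fin g → ZMod (p ^ n))
    (h : r < n / 2 → ∀ f ∈ Vpm p n g (r + 1) ε,
      f (p ^ r • z) + ((ε : ℤ) : ℂ) * f (-(p ^ r • z)) - star b * f 0 = 0) :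
    testFunction p n g r ε b (p ^ r • z) ∈ Upm p n g r ε := by
  have h1 := testFunction_mem_Vpm (show 2 * r ≤ n by omega) hb z
  unfold Upm
  split_ifs with hlt
  · refine ⟨h1, (Submodule.mem_orthogonal' _ _).2 fun f hf => ?_⟩
    have hf2 : ∀ u v : Fin g → ZMod (p ^ n), f (u + p ^ (n - r) • v) = f u := by
      intro u v
      have e : p ^ (n - r) • v = p ^ (n - (r + 1)) • (p • v) := by
        rw [smul_smul, ← pow_succ]
        congr 2
        omega
      rw [e]
      exact hf.1.2 _ _
    have hsmul : ∀ (a : ℂ) (x : L2 (p ^ n) g), inner ℂ (a • x) f = star a * inner ℂ x f :=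
      fun a x => inner_smul_left x f a
    rw [testFunction, inner_sub_left, inner_add_left, hsmul, hsmul, star_intCast,
      inner_cosetIndicator hf2, inner_cosetIndicator hf2, inner_cosetIndicator hf2]
    have h2 := h hlt f hf
    linear_combination (∑ u, cosetIndicator p n g r 0 u) * h2
  · exact h1

theorem testFunction_apply_self (hp : Odd p) (hr : r ≤ n) (ε : ℤˣ) (b : ℂ)
    {z : Fin g → ZMod (p ^ n)} (i : Fin g) (hz : (p : ZMod (p ^ n)) ^ r * z i ≠ 0) :
    testFunction p n g r ε b z z = 1 := by
  have h1 : (p : ZMod (p ^ n)) ^ r * (z i - (-z) i) ≠ 0 := by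
    intro h
    apply hz
    have hh := half (hp.pow : Odd (p ^ n))
    rw [Pi.neg_apply] at h
    linear_combination (2 : ZMod (p ^ n))⁻¹ * h - (p : ZMod (p ^ n)) ^ r * z i * hh
  have h2 : (p : ZMod (p ^ n)) ^ r * (z i - (0 : Fin g → ZMod (p ^ n)) i) ≠ 0 := by
    simpa using hz
  simp [testFunction, cosetIndicator_apply_self, cosetIndicator_eq_zero i hr h1,
    cosetIndicator_eq_zero i hr h2, -Nat.cast_pow]

/-- The kernel of reduction modulo `p ^ m` does not act by scalars on `U_{n-2r}` for `m < n - 2r`: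
a shear in this kernel acts by a phase taking two distinct values on supports of functions in
`U_{n-2r}`. -/
theorem not_actsByScalars_restrict_Upm (hp : Odd p) (hg : 0 < g) (hr : r ≤ n / 2) (ε : ℤˣ)
    (hex : ¬ (p = 3 ∧ g = 1 ∧ n - 2 * r = 1 ∧ ε = -1))
    (hU : (weilRep g (hp.pow : Odd (p ^ n))).IsInvariant (Upm p n g r ε)) {m : ℕ} (hm : m ≤ n)
    (hlt : m < n - 2 * r) :
    ¬ ((weilRep g (hp.pow : Odd (p ^ n))).restrict (Upm p n g r ε) hU).ActsByScalars
      (reduction p g hm).ker := by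
  intro hs
  have hpp : p.Prime := Fact.out
  have hp1 : ¬ p ∣ 1 := hpp.one_lt.ne' ∘ Nat.dvd_one.1
  have hp2 : ¬ p ∣ 2 := fun h => by
    have := (Nat.prime_dvd_prime_iff_eq hpp Nat.prime_two).1 h
    subst this
    exact absurd hp (by decide)
  let i : Fin g := ⟨0, hg⟩
  have hne : (p : ZMod (p ^ n)) ^ (n - 1) ≠ 0 := by
    have := pow_mul_natCast_ne_zero (p := p) (n := n) (k := n - 1) (c := 1) (by omega) hp1
    simpa [-Nat.cast_pow] using this
  -- The function attached to `z = p ^ r e_i`, which lies outside `p ^ (r + 1) A`.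
  have hf : testFunction p n g r ε 0 (p ^ r • Pi.single i 1) ∈ Upm p n g r ε := by
    refine testFunction_mem_Upm hr (mul_zero _) _ fun hr' h hh => ?_
    have h0 : ¬ ∃ v : Fin g → ZMod (p ^ n), p ^ r • Pi.single i 1 = p ^ (r + 1) • v := by
      rintro ⟨v, hv⟩
      have h1 := congrArg (fun a => (p : ZMod (p ^ n)) ^ (n - 1 - r) * a) (congrFun hv i)
      simp only [pow_smul_apply, ← mul_assoc, ← pow_add, Pi.single_eq_same, mul_one] at h1
      rw [natCast_pow_eq_zero (show n ≤ n - 1 - r + (r + 1) by omega), zero_mul,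
        show n - 1 - r + r = n - 1 by omega] at h1
      exact hne h1
    have h1 := hh.1.1 _ h0
    rw [hh.2, h1]
    simp
  have hfz : testFunction p n g r ε 0 (p ^ r • Pi.single i 1) (p ^ r • Pi.single i 1) ≠ 0 := by
    rw [testFunction_apply_self hp (by omega) ε 0 i]
    · exact one_ne_zero
    · have := pow_mul_natCast_ne_zero (p := p) (n := n) (k := r + r) (c := 1) (by omega) hp1
      rw [pow_smul_apply, ← mul_assoc, ← pow_add]
      simpa [-Nat.cast_pow] using this
  have key := fun {f' : L2 (p ^ n) g} (hf' : f' ∈ Upm p n g r ε) {u' : Fin g → ZMod (p ^ n)}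
    (hu' : f' u' ≠ 0) => quadratic_eq_of_actsByScalars hp hU hm
      (show m ≤ n - 2 * r - 1 by omega) hs i hf hf' hfz hu'
  have e0 : (p : ZMod (p ^ n)) ^ (n - 2 * r - 1) *
      ((p ^ r • Pi.single i 1 : Fin g → ZMod (p ^ n)) i) ^ 2 = (p : ZMod (p ^ n)) ^ (n - 1) := by
    rw [pow_smul_apply, Pi.single_eq_same, mul_one, ← pow_mul, ← pow_add]
    congr 1
    omega
  simp only [e0] at key
  by_cases hM : n - 2 * r = 1
  · have hr' : ¬ r < n / 2 := by omega
    rcases Int.units_eq_one_or ε with rfl | rfl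
    · -- The indicator of `p ^ (n - r) A` is even, and the phase is trivial at the origin.
      have h1 := key (testFunction_mem_Upm (b := 0) hr (mul_zero _) 0 fun h => absurd h hr')
        (u' := 0) (by simp [testFunction, cosetIndicator_apply_self])
      rw [Pi.zero_apply, zero_pow two_ne_zero, mul_zero] at h1
      exact hne h1
    · by_cases hg1 : g = 1
      · -- Compare the phase at `p ^ r e_i` and `2 p ^ r e_i`; this needs `p ≠ 3`.
        have hp3 : ¬ p ∣ 3 := fun h =>
          hex ⟨(Nat.prime_dvd_prime_iff_eq hpp Nat.prime_three).1 h, hg1, hM, rfl⟩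
        have h1 := key (testFunction_mem_Upm (b := 0) hr (mul_zero _) (Pi.single i 2)
            fun h => absurd h hr') (u' := p ^ r • Pi.single i 2) (by
          rw [testFunction_apply_self hp (by omega) (-1) 0 i]
          · exact one_ne_zero
          · have := pow_mul_natCast_ne_zero (p := p) (n := n) (k := r + r) (c := 2) (by omega) hp2
            rw [pow_smul_apply, ← mul_assoc, ← pow_add, Pi.single_eq_same]
            exact_mod_cast this)
        rw [pow_smul_apply, Pi.single_eq_same] at h1
        refine pow_mul_natCast_ne_zero (p := p) (n := n) (k := n - 1) (c := 3) (by omega) hp3 ?_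
        have e1 : (p : ZMod (p ^ n)) ^ (n - 2 * r - 1) * ((p : ZMod (p ^ n)) ^ r * 2) ^ 2 =
            (p : ZMod (p ^ n)) ^ (n - 1) * 4 := by
          rw [show n - 1 = (n - 2 * r - 1) + r * 2 by omega, pow_add, pow_mul]
          ring
        rw [e1] at h1
        push_cast
        linear_combination -h1
      · -- Compare the phase at `p ^ r e_i` and at a multiple of another unit vector.
        let j : Fin g := ⟨1, by omega⟩
        have hij : i ≠ j := by simp [i, j]
        have h1 := key (testFunction_mem_Upm (b := 0) hr (mul_zero _) (Pi.single j 1)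
            fun h => absurd h hr') (u' := p ^ r • Pi.single j 1) (by
          rw [testFunction_apply_self hp (by omega) (-1) 0 j]
          · exact one_ne_zero
          · have := pow_mul_natCast_ne_zero (p := p) (n := n) (k := r + r) (c := 1) (by omega) hp1
            rw [pow_smul_apply, ← mul_assoc, ← pow_add]
            simpa [-Nat.cast_pow] using this)
        rw [pow_smul_apply, Pi.single_eq_of_ne hij, mul_zero, zero_pow two_ne_zero, mul_zero] at h1
        exact hne h1
  · -- The function attached to `z = p ^ (n - r - 1) e_i`; functions in `V_{n-2r-2}` take the same
    -- value at `z`, `-z` and `0`, which dictates the coefficient `1 + ε` of `δ_0`.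
    have e1 : (p ^ r • Pi.single i ((p : ZMod (p ^ n)) ^ (n - 2 * r - 1)) : Fin g → ZMod (p ^ n)) =
        p ^ (n - (r + 1)) • Pi.single i 1 := by
      ext j
      rw [pow_smul_apply, pow_smul_apply]
      by_cases hj : j = i
      · subst hj
        rw [Pi.single_eq_same, Pi.single_eq_same, mul_one, ← pow_add]
        congr 1
        omega
      · rw [Pi.single_eq_of_ne hj, Pi.single_eq_of_ne hj, mul_zero, mul_zero]
    have hb : ((ε : ℤ) : ℂ) * (1 + ((ε : ℤ) : ℂ)) = 1 + ((ε : ℤ) : ℂ) := by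
      rcases Int.units_eq_one_or ε with rfl | rfl <;> simp
    have h1 := key (testFunction_mem_Upm (b := 1 + ((ε : ℤ) : ℂ)) hr hb
      (Pi.single i ((p : ZMod (p ^ n)) ^ (n - 2 * r - 1))) fun hr' h hh => by
        have h2 : h (p ^ (n - (r + 1)) • Pi.single i 1) = h 0 := by
          have := hh.1.2 0 (Pi.single i 1)
          rwa [zero_add] at this
        have h3 : h (-(p ^ (n - (r + 1)) • Pi.single i 1)) = h 0 := by
          have := hh.1.2 0 (-Pi.single i 1)
          rwa [zero_add, smul_neg] at this
        rw [e1, h2, h3, star_add, star_one, star_intCast]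
        ring)
      (u' := p ^ r • Pi.single i ((p : ZMod (p ^ n)) ^ (n - 2 * r - 1))) (by
        rw [testFunction_apply_self hp (by omega) ε _ i]
        · exact one_ne_zero
        · rw [pow_smul_apply, Pi.single_eq_same, ← pow_add, ← pow_add,
            show r + (r + (n - 2 * r - 1)) = n - 1 by omega]
          exact hne)
    rw [pow_smul_apply, Pi.single_eq_same, ← pow_add, ← pow_mul, ← pow_add,
      natCast_pow_eq_zero (show n ≤ n - 2 * r - 1 + (r + (n - 2 * r - 1)) * 2 by omega)] at h1
    exact hne h1

end Level

end FiniteWeil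

end
theorem mainTheorem12 (p n g r : ℕ) [Fact p.Prime] (hp : Odd p) (hn : 0 < n) (hg : 0 < g)
    (hr : r ≤ n / 2) :
    (∀ ε : ℤˣ, ∃ hU : (FiniteWeil.weilRep g (hp.pow : Odd (p ^ n))).IsInvariant
        (FiniteWeil.Upm p n g r ε),
      ¬ (p = 3 ∧ g = 1 ∧ n - 2 * r = 1 ∧ ε = -1) →
        FiniteWeil.HasLevel
          ((FiniteWeil.weilRep g (hp.pow : Odd (p ^ n))).restrict (FiniteWeil.Upm p n g r ε) hU)
          (n - 2 * r)) ∧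
    ∃ hV : (FiniteWeil.weilRep g (hp.pow : Odd (p ^ n))).IsInvariant (FiniteWeil.V p n g r),
      ((FiniteWeil.weilRep g (hp.pow : Odd (p ^ (n - 2 * r)))).comp
          (FiniteWeil.reduction p g (Nat.sub_le n (2 * r)))).Equivalent
        ((FiniteWeil.weilRep g (hp.pow : Odd (p ^ n))).restrict (FiniteWeil.V p n g r) hV) := by
  refine ⟨fun ε => ⟨FiniteWeil.isInvariant_Upm hp hr ε, fun hex => ⟨⟨Nat.sub_le n (2 * r),
    FiniteWeil.actsByScalars_restrict_Upm hp hr ε _⟩, ?_⟩⟩,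
    FiniteWeil.isInvariant_V hp (by omega), FiniteWeil.equivalent_restrict_V hp (by omega) _⟩
  rintro m ⟨hm, hs⟩
  by_contra! hlt
  exact FiniteWeil.not_actsByScalars_restrict_Upm hp hg hr ε hex _ hm hlt hs
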